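/- Let $1<s<2$ and $D=-i\partial_x$ on $\mathbb R$. Let $Q$ be a ground state, i.e. a function $Q\in H^{s/2}(\mathbb R)$, $Q>0$, which solves $|D|^sQ+Q=Q^{2s+1}$ and is an optimizer of the Gagliardo–Nirenberg inequality $$\int_{\mathbb R}|v|^{2s+2}\le C\Big(\int_{\mathbb R}\bar v\,|D|^sv\Big)\Big(\int_{\mathbb R}|v|^2\Big)^s,\qquad v\in H^{s/2}(\mathbb R).$$ Let $\beta>0$ and $0<N<\|Q\|_{L^2}^2$. Then the minimization problem $$E_\beta(N)=\inf\Big\{\tfrac12\int_{\mathbb R}\bar u\,|D|^su-\beta\int_{\mathbb R}\bar u\,Du-\tfrac1{2s+2}\int_{\mathbb R}|u|^{2s+2}\;:\;u\in H^{s/2}(\mathbb R),\ \int_{\mathbb R}|u|^2=N\Big\}$$ has a minimizer $Q_{\beta,N}\in H^{s/2}(\mathbb R)$, $\|Q_{\beta,N}\|_{L^2}^2=N$, that satisfies $$\big(|D|^s-2\beta D+\gamma\big)Q_{\beta,N}=Q_{\beta,N}|Q_{\beta,N}|^{2s}$$ for some $\gamma=\gamma(\beta,N)\in\mathbb R$.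 -/

import Mathlib

open MeasureTheory FourierTransform
open scoped SchwartzMap

noncomputable section

namespace FracNLS

/-- The space `L²(ℝ; ℂ)`. -/
abbrev L2 : Type := Lp ℂ 2 (volume : Measure ℝ)

/-- The Sobolev space `H^r(ℝ)`, `r ≥ 0`, as a subset of `L²(ℝ; ℂ)`: the `u` whose tempered
distribution lies in the Bessel potential space of order `r`. -/
def sobolev (r : ℝ) : Set L2 :=
  {u | TemperedDistribution.MemSobolev r 2 (u : 𝓢'(ℝ, ℂ))}

/-- The mass `∫ |u|²`. -/
def mass (u : L2) : ℝ := ∫ x, ‖u x‖ ^ 2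

/-- The potential term `∫ |u|^{2s+2}`. -/
def potential (s : ℝ) (u : L2) : ℝ := ∫ x, ‖u x‖ ^ (2 * s + 2)

/-- The quadratic form `∫ ū m(D) u` of the Fourier multiplier `m(D)`, `D = -i ∂ₓ`, computed on the
Fourier side. The Fourier transform here is `𝓕 u (ξ) = ∫ e^{-2πixξ} u(x) dx`, extended to `L²`; it
is an isometry of `L²` and turns `D` into multiplication by `2πξ`. -/
def quadForm (m : ℝ → ℝ) (u : L2) : ℝ :=
  ∫ ξ, m (2 * Real.pi * ξ) * ‖(𝓕 u : L2) ξ‖ ^ 2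

/-- `∫ ū |D|^s u`. -/
def kinetic (s : ℝ) (u : L2) : ℝ := quadForm (fun k => |k| ^ s) u

/-- `∫ ū D u`. -/
def momentum (u : L2) : ℝ := quadForm (fun k => k) u

/-- `𝓔_β(u) = ½ ∫ ū|D|^s u - β ∫ ū D u - 1/(2s+2) ∫ |u|^{2s+2}`. -/
def energy (s β : ℝ) (u : L2) : ℝ :=
  1 / 2 * kinetic s u - β * momentum u - 1 / (2 * s + 2) * potential s u

/-- The constraint set of `E_β(N)`: all `u ∈ H^{s/2}(ℝ)` with `∫ |u|² = N`. -/
def admissible (s N : ℝ) : Set L2 := {u | u ∈ sobolev (s / 2) ∧ mass u = N}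

/-- `u` is a minimizer of `E_β(N) = inf {𝓔_β(v) : v ∈ H^{s/2}(ℝ), ∫ |v|² = N}`. -/
def IsMinimizer (s β N : ℝ) (u : L2) : Prop :=
  u ∈ admissible s N ∧ IsMinOn (energy s β) (admissible s N) u

/-- `m(D) u = f`, where `m(D)` is the Fourier multiplier with symbol `m` and `u, f ∈ L²`. -/
def MultiplierEq (m : ℝ → ℝ) (u f : L2) : Prop :=
  (fun ξ : ℝ => (m (2 * Real.pi * ξ) : ℂ) * (𝓕 u : L2) ξ) =ᵐ[volume] (𝓕 f : L2)

/-- `(|D|^s - 2βD + γ) u = u |u|^{2s}`; the right-hand side belongs to `L²` and the equation holds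
in `L²`. -/
def SolvesTravellingWave (s β γ : ℝ) (u : L2) : Prop :=
  ∃ f : L2, (f =ᵐ[volume] fun x => u x * ((‖u x‖ ^ (2 * s) : ℝ) : ℂ)) ∧
    MultiplierEq (fun k => |k| ^ s - 2 * β * k + γ) u f

/-- `Q` is an optimizer of the Gagliardo-Nirenberg inequality
`∫ |v|^{2s+2} ≤ C (∫ v̄|D|^s v) (∫ |v|²)^s` on `H^{s/2}(ℝ)`: it is nonzero and maximizes the quotient
of the two sides (written without division). -/
def IsGNOptimizer (s : ℝ) (Q : L2) : Prop :=
  Q ∈ sobolev (s / 2) ∧ Q ≠ 0 ∧ ∀ v ∈ sobolev (s / 2),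
    potential s v * (kinetic s Q * mass Q ^ s) ≤ potential s Q * (kinetic s v * mass v ^ s)

/-- `Q` is a ground state: a positive function in `H^{s/2}(ℝ)` with `|D|^s Q + Q = Q^{2s+1}`, so that
`Q(x) e^{it}` solves `i∂ₜu - |D|^s u + u|u|^{2s} = 0`, which is an optimizer of the
Gagliardo-Nirenberg inequality. -/
def IsGroundState (s : ℝ) (Q : L2) : Prop :=
  (∀ᵐ x, 0 < (Q x).re ∧ (Q x).im = 0) ∧ SolvesTravellingWave s 0 1 Q ∧ IsGNOptimizer s Q

end FracNLS

end

noncomputable section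

namespace FracNLS

/-! A minimizing sequence for the infimum E is compact up to translation: it stays bounded, cannot
vanish and cannot split.

Boundedness. Comparing the Euler-Lagrange equation of the Gagliardo-Nirenberg quotient with the
ground state equation forces ∫ Q^{2s+2} = (s+1) ∫ Q |D|^s Q. The sharp constant is thus
(s+1)/‖Q‖^{2s}, and for N < ‖Q‖² the potential term absorbs only the fraction (N/‖Q‖²)^s < 1 of the
kinetic term. As s > 1, the momentum term is of lower order (`IsGroundState.exists_coercive`).

No vanishing. The symbol ½|k|^s - βk has a minimum μ, attained at some q > 0, so the linear part of
the energy is at least μN. A wave packet of frequency width b^{-1/2} around q costs O(1/b) above μN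
and gains a multiple of b^{-s/2} from the potential; since s < 2 the gain wins for large b, and E <
μN (`exists_energy_lt`). The potential is at most ‖v‖_∞^{2s} N, so functions of nearly minimal
energy have sup norm bounded below, and a translation moves a point of large modulus to 0. Because
s/2 > 1/2, evaluation at 0 is weakly continuous on H^{s/2}, and the weak limit u is nonzero.

No splitting. Weak convergence decouples the quadratic forms (`exists_sobolev_limit`), and the
Brezis-Lieb lemma decouples the potential. Rescaling v to mass N shows that its energy is at least
(mass v / N) E plus a positive multiple of ((N / mass v)^s - 1) times its potential
(`le_energy_of_scaling`). Applied to u and to the remainders, this contradicts the additivity of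
mass and energy unless u has mass N; then u attains E.

For the equation, the constraint is removed by homogeneity: rescaling turns minimality into
nonnegativity of an unconstrained functional that vanishes at u, whose first variation is computed
in `euler_lagrange`. The same lemma serves for Q. -/

/-! ### Sobolev spaces on the Fourier side. -/

/-- The weight `(1 + ξ²)^{r/2}` of the Sobolev space `H^r`. -/
def weight (r ξ : ℝ) : ℝ := (1 + ξ ^ 2) ^ (r / 2)

lemma weight_pos (r ξ : ℝ) : 0 < weight r ξ := by unfold weight; positivity

lemma one_le_weight {r : ℝ} (hr : 0 ≤ r) (ξ : ℝ) : 1 ≤ weight r ξ :=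
  Real.one_le_rpow (by nlinarith [sq_nonneg ξ]) (by positivity)

lemma weight_sq (r ξ : ℝ) : weight r ξ ^ 2 = (1 + ξ ^ 2) ^ r := by
  unfold weight
  rw [← Real.rpow_natCast, ← Real.rpow_mul (by positivity)]
  congr 1; push_cast; ring

lemma continuous_weight (r : ℝ) : Continuous (weight r) := by
  unfold weight
  exact (by fun_prop : Continuous fun ξ : ℝ => 1 + ξ ^ 2).rpow_const
    (fun ξ => Or.inl (by positivity))

lemma hasTemperateGrowth_weight (r : ℝ) :
    (fun ξ : ℝ => (weight r ξ : ℂ)).HasTemperateGrowth := by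
  have : (fun ξ : ℝ => (((1 + ‖ξ‖ ^ 2) ^ (r / 2) : ℝ) : ℂ)).HasTemperateGrowth := by fun_prop
  simpa [weight] using this

/-- Smooth compactly supported functions are Schwartz, so this is the fundamental lemma of the
calculus of variations. It passes from tempered distributions to functions. -/
lemma ae_eq_of_integral_schwartz {f g : ℝ → ℂ} (hf : LocallyIntegrable f volume)
    (hg : LocallyIntegrable g volume)
    (h : ∀ φ : 𝓢(ℝ, ℂ), ∫ x, φ x • f x = ∫ x, φ x • g x) : f =ᵐ[volume] g := by
  refine ae_eq_of_integral_contDiff_smul_eq hf hg fun φ hφ hc => ?_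
  have hc' : HasCompactSupport (Complex.ofRealCLM ∘ φ) := hc.comp_left rfl
  have hφ' : ContDiff ℝ (⊤ : ℕ∞) (Complex.ofRealCLM ∘ φ) := Complex.ofRealCLM.contDiff.comp hφ
  simpa using h (hc'.toSchwartzMap hφ')

lemma locallyIntegrable_coe (u : L2) : LocallyIntegrable (u : ℝ → ℂ) volume :=
  (Lp.memLp u).locallyIntegrable (by norm_num)

/-- Membership in `H^r` on the Fourier side. -/
lemma mem_sobolev_iff {r : ℝ} {u : L2} :
    u ∈ sobolev r ↔ MemLp (fun ξ => (weight r ξ : ℂ) * (𝓕 u : L2) ξ) 2 volume := by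
  have hw : (fun ξ : ℝ => (((1 + ‖ξ‖ ^ 2) ^ (r / 2) : ℝ) : ℂ)) = fun ξ => (weight r ξ : ℂ) := by
    ext ξ; simp [weight]
  have key : ∀ f : L2, (TemperedDistribution.smulLeftCLM ℂ (fun ξ => (weight r ξ : ℂ))
      (𝓕 u : L2) = (f : 𝓢'(ℝ, ℂ))) ↔
      (fun ξ => (weight r ξ : ℂ) * (𝓕 u : L2) ξ) =ᵐ[volume] f := by
    intro f
    have hl : ∀ φ : 𝓢(ℝ, ℂ), (TemperedDistribution.smulLeftCLM ℂ (fun ξ => (weight r ξ : ℂ))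
        (𝓕 u : L2) : 𝓢'(ℝ, ℂ)) φ = ∫ ξ, φ ξ • ((weight r ξ : ℂ) * (𝓕 u : L2) ξ) := by
      intro φ
      rw [TemperedDistribution.smulLeftCLM_apply_apply, Lp.toTemperedDistribution_apply]
      congr 1; ext ξ
      rw [SchwartzMap.smulLeftCLM_apply_apply (hasTemperateGrowth_weight r)]
      simp only [smul_eq_mul]; ring
    constructor
    · intro h
      refine ae_eq_of_integral_schwartz ?_ (locallyIntegrable_coe f) fun φ => ?_
      · have := (locallyIntegrable_coe (𝓕 u)).continuous_smul
          (Complex.continuous_ofReal.comp (continuous_weight r))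
        exact this
      · rw [← hl, h, Lp.toTemperedDistribution_apply]
    · intro h
      ext φ
      rw [hl, Lp.toTemperedDistribution_apply]
      refine integral_congr_ae ?_
      filter_upwards [h] with ξ hξ
      rw [hξ]
  unfold sobolev
  rw [Set.mem_ofPred_eq, TemperedDistribution.memSobolev_iff_exists_smulLeftCLM_fourier, hw,
    Lp.fourier_toTemperedDistribution_eq]
  constructor
  · rintro ⟨f, hf⟩
    exact (Lp.memLp f).ae_eq ((key f).1 hf).symm
  · intro h
    exact ⟨h.toLp _, (key _).2 h.coeFn_toLp.symm⟩

/-- On `L¹ ∩ L²` the inverse Fourier transform is given by the integral. -/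
lemma fourierInv_ae_eq (h : L2) (hi : Integrable (h : ℝ → ℂ)) :
    ((𝓕⁻ h : L2) : ℝ → ℂ) =ᵐ[volume] 𝓕⁻ (h : ℝ → ℂ) := by
  have hinv : 𝓕⁻ (h : ℝ → ℂ) = 𝓕 (fun ξ => h (-ξ)) := Real.fourierInv_eq_fourier_comp_neg _
  have hi' : Integrable (fun ξ => h (-ξ)) := hi.comp_neg
  refine ae_eq_of_integral_schwartz (locallyIntegrable_coe _) ?_ fun φ => ?_
  · rw [hinv]
    exact (VectorFourier.fourierIntegral_continuous Real.continuous_fourierChar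
      (L := innerₗ ℝ) (by exact continuous_inner) hi').locallyIntegrable
  · rw [← Lp.toTemperedDistribution_apply, ← Lp.fourierInv_toTemperedDistribution_eq,
      TemperedDistribution.fourierInv_apply, Lp.toTemperedDistribution_apply, hinv]
    -- The multiplication formula ∫ φ̂ h = ∫ φ ĥ, with h reflected, matches the distributional
    -- definition of the inverse transform.
    have := VectorFourier.integral_fourierIntegral_smul_eq_flip (μ := volume) (ν := volume)
      Real.continuous_fourierChar (L := innerₗ ℝ) (by exact continuous_inner) φ.integrable hi'
    rw [flip_innerₗ] at this
    refine Eq.trans ?_ this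
    rw [← integral_neg_eq_self]
    refine integral_congr_ae (Filter.Eventually.of_forall fun ξ => ?_)
    simp only [SchwartzMap.fourierInv_coe, Real.fourierInv_eq_fourier_neg, neg_neg]
    rfl

lemma fourier_add_ae (u v : L2) :
    ((𝓕 (u + v) : L2) : ℝ → ℂ) =ᵐ[volume] fun ξ => (𝓕 u : L2) ξ + (𝓕 v : L2) ξ := by
  rw [FourierTransform.fourier_add]; exact Lp.coeFn_add _ _

lemma fourier_sub_ae (u v : L2) :
    ((𝓕 (u - v) : L2) : ℝ → ℂ) =ᵐ[volume] fun ξ => (𝓕 u : L2) ξ - (𝓕 v : L2) ξ := by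
  have : (𝓕 (u - v) : L2) = 𝓕 u - 𝓕 v := (Lp.fourierTransformₗᵢ ℝ ℂ).map_sub u v
  rw [this]; exact Lp.coeFn_sub _ _

lemma fourier_smul_ae (c : ℂ) (u : L2) :
    ((𝓕 (c • u) : L2) : ℝ → ℂ) =ᵐ[volume] fun ξ => c * (𝓕 u : L2) ξ := by
  rw [FourierTransform.fourier_smul]; exact Lp.coeFn_smul _ _

lemma add_mem_sobolev {r : ℝ} {u v : L2} (hu : u ∈ sobolev r) (hv : v ∈ sobolev r) :
    u + v ∈ sobolev r := by
  rw [mem_sobolev_iff] at *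
  refine (hu.add hv).ae_eq ?_
  filter_upwards [fourier_add_ae u v] with ξ h
  simp only [Pi.add_apply, h]; ring

lemma sub_mem_sobolev {r : ℝ} {u v : L2} (hu : u ∈ sobolev r) (hv : v ∈ sobolev r) :
    u - v ∈ sobolev r := by
  rw [mem_sobolev_iff] at *
  refine (hu.sub hv).ae_eq ?_
  filter_upwards [fourier_sub_ae u v] with ξ h
  simp only [Pi.sub_apply, h]; ring

lemma smul_mem_sobolev {r : ℝ} {u : L2} (c : ℂ) (hu : u ∈ sobolev r) : c • u ∈ sobolev r := by
  rw [mem_sobolev_iff] at *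
  refine (hu.const_mul c).ae_eq ?_
  filter_upwards [fourier_smul_ae c u] with ξ h
  simp only [h]; ring

lemma fourierInv_mem_sobolev {r : ℝ} {h : L2}
    (hh : MemLp (fun ξ => (weight r ξ : ℂ) * h ξ) 2 volume) : (𝓕⁻ h : L2) ∈ sobolev r := by
  rw [mem_sobolev_iff, FourierTransform.fourier_fourierInv_eq]; exact hh

/-! ### Mass and quadratic forms of Fourier multipliers. -/

lemma mass_eq_norm_sq (u : L2) : mass u = ‖u‖ ^ 2 := by
  have := L2.inner_def (𝕜 := ℂ) u u
  rw [inner_self_eq_norm_sq_to_K] at this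
  have h2 : ∫ a, inner ℂ (u a) (u a) = ((∫ a, ‖u a‖ ^ 2 : ℝ) : ℂ) := by
    rw [← integral_complex_ofReal]
    congr 1; ext a
    rw [inner_self_eq_norm_sq_to_K]; simp
  rw [h2] at this
  unfold mass
  exact (Complex.ofReal_injective (by simpa using this)).symm

lemma mass_nonneg (u : L2) : 0 ≤ mass u := by rw [mass_eq_norm_sq]; positivity

lemma mass_eq_zero {u : L2} : mass u = 0 ↔ u = 0 := by
  rw [mass_eq_norm_sq]; simp

lemma mass_pos {u : L2} (hu : u ≠ 0) : 0 < mass u := by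
  rw [mass_eq_norm_sq]; positivity

lemma mass_fourier (u : L2) : mass (𝓕 u : L2) = mass u := by
  rw [mass_eq_norm_sq, mass_eq_norm_sq, Lp.norm_fourier_eq]

lemma quadForm_const (c : ℝ) (u : L2) : quadForm (fun _ => c) u = c * mass u := by
  unfold quadForm
  rw [integral_const_mul, ← mass_fourier]; rfl

/-- Measurable symbols whose quadratic form is bounded on `H^r`. -/
def IsSymbol (r : ℝ) (m : ℝ → ℝ) : Prop :=
  Measurable m ∧ ∃ C, ∀ ξ, |m (2 * Real.pi * ξ)| ≤ C * weight r ξ ^ 2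

lemma IsSymbol.add {r : ℝ} {m n : ℝ → ℝ} (hm : IsSymbol r m) (hn : IsSymbol r n) :
    IsSymbol r (fun k => m k + n k) := by
  obtain ⟨h1, C, hC⟩ := hm
  obtain ⟨h2, D, hD⟩ := hn
  refine ⟨h1.add h2, C + D, fun ξ => (abs_add_le _ _).trans ?_⟩
  rw [add_mul]; exact add_le_add (hC ξ) (hD ξ)

lemma IsSymbol.const_mul {r : ℝ} {m : ℝ → ℝ} (hm : IsSymbol r m) (c : ℝ) :
    IsSymbol r (fun k => c * m k) := by
  obtain ⟨h1, C, hC⟩ := hm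
  refine ⟨h1.const_mul c, |c| * C, fun ξ => ?_⟩
  rw [abs_mul, mul_assoc |c|]; exact mul_le_mul_of_nonneg_left (hC ξ) (abs_nonneg c)

lemma isSymbol_const {r : ℝ} (hr : 0 ≤ r) (c : ℝ) : IsSymbol r (fun _ => c) :=
  ⟨measurable_const, |c|, fun ξ => le_mul_of_one_le_right (abs_nonneg c)
    (one_le_pow₀ (one_le_weight hr ξ))⟩

lemma isSymbol_abs_rpow {s : ℝ} (hs : 0 ≤ s) : IsSymbol (s / 2) (fun k => |k| ^ s) := by
  refine ⟨by fun_prop, (2 * Real.pi) ^ s, fun ξ => ?_⟩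
  have h1 : |ξ| ^ s ≤ weight (s / 2) ξ ^ 2 := by
    rw [weight_sq]
    have : |ξ| ^ s = (ξ ^ 2) ^ (s / 2) := by
      rw [← sq_abs, ← Real.rpow_natCast, ← Real.rpow_mul (abs_nonneg _)]
      congr 1; push_cast; ring
    rw [this]
    exact Real.rpow_le_rpow (by positivity) (by linarith) (by positivity)
  have h2 : |2 * Real.pi * ξ| ^ s = (2 * Real.pi) ^ s * |ξ| ^ s := by
    rw [abs_mul, abs_of_pos (by positivity), Real.mul_rpow (by positivity) (abs_nonneg _)]
  simp only [h2]
  rw [abs_of_nonneg (by positivity)]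
  exact mul_le_mul_of_nonneg_left h1 (by positivity)

lemma isSymbol_id {r : ℝ} (hr : 1 / 2 ≤ r) : IsSymbol r (fun k => k) := by
  refine ⟨measurable_id, 2 * Real.pi, fun ξ => ?_⟩
  rw [abs_mul, abs_of_pos (by positivity : 0 < 2 * Real.pi)]
  refine mul_le_mul_of_nonneg_left ?_ (by positivity)
  rw [weight_sq]
  calc |ξ| ≤ (1 + ξ ^ 2) ^ (1 / 2 : ℝ) := by
        rw [← Real.sqrt_eq_rpow]
        exact Real.abs_le_sqrt (by linarith)
    _ ≤ _ := Real.rpow_le_rpow_of_exponent_le (by nlinarith [sq_nonneg ξ]) hr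

/-- The real bilinear form polarizing `quadForm m`. -/
def bilForm (m : ℝ → ℝ) (u v : L2) : ℝ :=
  ∫ ξ, m (2 * Real.pi * ξ) * inner ℝ ((𝓕 u : L2) ξ) ((𝓕 v : L2) ξ)

lemma aestronglyMeasurable_symbol {m : ℝ → ℝ} (hm : Measurable m) :
    AEStronglyMeasurable (fun ξ : ℝ => m (2 * Real.pi * ξ)) volume :=
  (hm.comp (by fun_prop)).aestronglyMeasurable

lemma integrable_bilForm {r : ℝ} {m : ℝ → ℝ} (hm : IsSymbol r m) {u v : L2}
    (hu : u ∈ sobolev r) (hv : v ∈ sobolev r) :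
    Integrable (fun ξ => m (2 * Real.pi * ξ) * inner ℝ ((𝓕 u : L2) ξ) ((𝓕 v : L2) ξ)) := by
  obtain ⟨h1, C, hC⟩ := hm
  rw [mem_sobolev_iff] at hu hv
  have hi := (hu.norm.integrable_mul hv.norm).const_mul C
  refine hi.mono' ((aestronglyMeasurable_symbol h1).mul
    ((Lp.aestronglyMeasurable _).inner (Lp.aestronglyMeasurable _))) ?_
  refine Filter.Eventually.of_forall fun ξ => ?_
  have hw := weight_pos r ξ
  simp only [Pi.mul_apply, norm_mul, Complex.norm_real, Real.norm_eq_abs, abs_of_pos hw]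
  calc _ ≤ (C * weight r ξ ^ 2) * (‖(𝓕 u : L2) ξ‖ * ‖(𝓕 v : L2) ξ‖) :=
        mul_le_mul (hC ξ) (abs_real_inner_le_norm _ _) (abs_nonneg _)
          ((abs_nonneg _).trans (hC ξ))
    _ = _ := by ring

lemma integrable_quadForm {r : ℝ} {m : ℝ → ℝ} (hm : IsSymbol r m) {u : L2} (hu : u ∈ sobolev r) :
    Integrable (fun ξ => m (2 * Real.pi * ξ) * ‖(𝓕 u : L2) ξ‖ ^ 2) := by
  simpa only [real_inner_self_eq_norm_sq] using integrable_bilForm hm hu hu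

lemma quadForm_add {r : ℝ} {m : ℝ → ℝ} (hm : IsSymbol r m) {u v : L2}
    (hu : u ∈ sobolev r) (hv : v ∈ sobolev r) :
    quadForm m (u + v) = quadForm m u + 2 * bilForm m u v + quadForm m v := by
  unfold quadForm bilForm
  rw [← integral_const_mul, ← integral_add (integrable_quadForm hm hu)
    ((integrable_bilForm hm hu hv).const_mul 2), ← integral_add _ (integrable_quadForm hm hv)]
  · refine integral_congr_ae ?_
    filter_upwards [fourier_add_ae u v] with ξ h
    rw [h, norm_add_sq_real]; ring
  · exact (integrable_quadForm hm hu).add ((integrable_bilForm hm hu hv).const_mul 2)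

lemma bilForm_real_smul (m : ℝ → ℝ) (u v : L2) (t : ℝ) :
    bilForm m u ((t : ℂ) • v) = t * bilForm m u v := by
  unfold bilForm
  rw [← integral_const_mul]
  refine integral_congr_ae ?_
  filter_upwards [fourier_smul_ae t v] with ξ h
  rw [h]
  have : (t : ℂ) * (𝓕 v : L2) ξ = t • (𝓕 v : L2) ξ := by simp
  rw [this, real_inner_smul_right]; ring

lemma quadForm_smul (m : ℝ → ℝ) (c : ℂ) (u : L2) :
    quadForm m (c • u) = ‖c‖ ^ 2 * quadForm m u := by
  unfold quadForm
  rw [← integral_const_mul]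
  refine integral_congr_ae ?_
  filter_upwards [fourier_smul_ae c u] with ξ h
  rw [h, norm_mul]; ring

lemma mass_smul (c : ℂ) (u : L2) : mass (c • u) = ‖c‖ ^ 2 * mass u := by
  rw [mass_eq_norm_sq, norm_smul, mass_eq_norm_sq]; ring

lemma potential_smul {s : ℝ} (c : ℂ) (u : L2) :
    potential s (c • u) = ‖c‖ ^ (2 * s + 2) * potential s u := by
  unfold potential
  rw [← integral_const_mul]
  refine integral_congr_ae ?_
  filter_upwards [Lp.coeFn_smul c u] with x h
  rw [h, Pi.smul_apply, norm_smul, Real.mul_rpow (norm_nonneg _) (norm_nonneg _)]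

lemma quadForm_add_symbol {r : ℝ} {m n : ℝ → ℝ} (hm : IsSymbol r m) (hn : IsSymbol r n) {u : L2}
    (hu : u ∈ sobolev r) : quadForm (fun k => m k + n k) u = quadForm m u + quadForm n u := by
  unfold quadForm
  rw [← integral_add (integrable_quadForm hm hu) (integrable_quadForm hn hu)]
  congr 1; ext ξ; ring

lemma quadForm_const_mul_symbol (m : ℝ → ℝ) (c : ℝ) (u : L2) :
    quadForm (fun k => c * m k) u = c * quadForm m u := by
  unfold quadForm
  rw [← integral_const_mul]
  congr 1; ext ξ; ring

lemma quadForm_mono {r : ℝ} {m n : ℝ → ℝ} (hm : IsSymbol r m) (hn : IsSymbol r n) {u : L2}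
    (hu : u ∈ sobolev r) (h : ∀ k, m k ≤ n k) : quadForm m u ≤ quadForm n u :=
  integral_mono (integrable_quadForm hm hu) (integrable_quadForm hn hu)
    fun ξ => mul_le_mul_of_nonneg_right (h _) (by positivity)

/-! ### Sobolev embedding and the continuous representative. -/

lemma memLp_inv_weight {r : ℝ} (hr : 1 / 2 < r) :
    MemLp (fun ξ => (((weight r ξ)⁻¹ : ℝ) : ℂ)) 2 volume := by
  have hc : Continuous fun ξ => (weight r ξ)⁻¹ :=
    (continuous_weight r).inv₀ fun ξ => (weight_pos r ξ).ne'
  suffices MemLp (fun ξ => (weight r ξ)⁻¹) 2 volume from this.ofReal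
  rw [memLp_two_iff_integrable_sq hc.aestronglyMeasurable]
  have := integrable_rpow_neg_one_add_norm_sq (E := ℝ) (μ := volume) (r := 2 * r)
    (by simp; linarith)
  refine this.congr (Filter.Eventually.of_forall fun ξ => ?_)
  simp only [Real.norm_eq_abs, sq_abs]
  rw [inv_pow, weight_sq, ← Real.rpow_neg (by positivity)]
  congr 1; ring

/-- `⟨ξ⟩^r û` as an element of `L²`. -/
def weighted {r : ℝ} {u : L2} (hu : u ∈ sobolev r) : L2 := (mem_sobolev_iff.1 hu).toLp _

lemma weighted_ae {r : ℝ} {u : L2} (hu : u ∈ sobolev r) :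
    (weighted hu : ℝ → ℂ) =ᵐ[volume] fun ξ => (weight r ξ : ℂ) * (𝓕 u : L2) ξ :=
  (mem_sobolev_iff.1 hu).coeFn_toLp

/-- The function representing evaluation at `x` on `H^r` is in `L²`. -/
lemma memLp_evalKernel {r : ℝ} (hr : 1 / 2 < r) (x : ℝ) :
    MemLp (fun ξ : ℝ => Complex.exp (((-(2 * Real.pi * ξ * x) : ℝ) : ℂ) * Complex.I) *
      (((weight r ξ)⁻¹ : ℝ) : ℂ)) 2 volume := by
  refine (memLp_inv_weight hr).mono ?_ ?_
  · exact (by fun_prop : Continuous fun ξ : ℝ =>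
      Complex.exp (((-(2 * Real.pi * ξ * x) : ℝ) : ℂ) * Complex.I)).aestronglyMeasurable.mul
      (memLp_inv_weight hr).1
  · refine Filter.Eventually.of_forall fun ξ => ?_
    rw [norm_mul, Complex.norm_exp_ofReal_mul_I, one_mul]

/-- The continuous representative of `u`, given by Fourier inversion. -/
def rep (u : L2) : ℝ → ℂ := 𝓕⁻ ((𝓕 u : L2) : ℝ → ℂ)

lemma rep_eq (u : L2) (x : ℝ) : rep u x =
    ∫ ξ : ℝ, Complex.exp (((2 * Real.pi * ξ * x : ℝ) : ℂ) * Complex.I) * (𝓕 u : L2) ξ := by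
  unfold rep
  rw [Real.fourierInv_eq']
  congr 1; ext ξ
  simp only [smul_eq_mul]
  congr 4
  simp; ring

lemma integrable_fourier {r : ℝ} (hr : 1 / 2 < r) {u : L2} (hu : u ∈ sobolev r) :
    Integrable ((𝓕 u : L2) : ℝ → ℂ) := by
  refine ((memLp_inv_weight hr).integrable_mul (mem_sobolev_iff.1 hu)).congr
    (Filter.Eventually.of_forall fun ξ => ?_)
  have : (weight r ξ : ℂ) ≠ 0 := by exact_mod_cast (weight_pos r ξ).ne'
  simp only [Pi.mul_apply]
  push_cast
  field_simp

lemma rep_ae {r : ℝ} (hr : 1 / 2 < r) {u : L2} (hu : u ∈ sobolev r) :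
    (u : ℝ → ℂ) =ᵐ[volume] rep u := by
  have := fourierInv_ae_eq (𝓕 u : L2) (integrable_fourier hr hu)
  rwa [FourierTransform.fourierInv_fourier_eq] at this

/-- Evaluation at a point is a bounded functional on H^r. Cauchy-Schwarz then gives the Sobolev
embedding, and weak convergence of the weighted transforms gives convergence at every point, without
local compactness arguments. -/
lemma rep_eq_inner {r : ℝ} (hr : 1 / 2 < r) {u : L2} (hu : u ∈ sobolev r) (x : ℝ) :
    rep u x = inner ℂ ((memLp_evalKernel hr x).toLp _) (weighted hu) := by
  rw [L2.inner_def, rep_eq]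
  refine integral_congr_ae ?_
  filter_upwards [weighted_ae hu, (memLp_evalKernel hr x).coeFn_toLp] with ξ h1 h2
  rw [h1, h2]
  have : (weight r ξ : ℂ) ≠ 0 := by exact_mod_cast (weight_pos r ξ).ne'
  simp only [RCLike.inner_apply, map_mul, Complex.conj_ofReal, ← Complex.exp_conj, Complex.conj_I]
  push_cast
  field_simp

lemma weighted_sub {r : ℝ} {u v : L2} (hu : u ∈ sobolev r) (hv : v ∈ sobolev r) :
    weighted (sub_mem_sobolev hu hv) = weighted hu - weighted hv := by
  refine Lp.ext ?_
  filter_upwards [weighted_ae hu, weighted_ae hv, weighted_ae (sub_mem_sobolev hu hv),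
    fourier_sub_ae u v, Lp.coeFn_sub (weighted hu) (weighted hv)] with ξ h1 h2 h3 h4 h5
  rw [h5, Pi.sub_apply, h1, h2, h3, h4]; ring

lemma rep_sub {r : ℝ} (hr : 1 / 2 < r) {u v : L2} (hu : u ∈ sobolev r) (hv : v ∈ sobolev r)
    (x : ℝ) : rep (u - v) x = rep u x - rep v x := by
  rw [rep_eq_inner hr hu, rep_eq_inner hr hv, rep_eq_inner hr (sub_mem_sobolev hu hv),
    ← inner_sub_right, weighted_sub hu hv]

/-- The Sobolev embedding `H^r ⊆ L^∞`. -/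
lemma exists_norm_rep_le {r : ℝ} (hr : 1 / 2 < r) :
    ∃ C, 0 ≤ C ∧ ∀ (u : L2) (hu : u ∈ sobolev r) (x : ℝ), ‖rep u x‖ ≤ C * ‖weighted hu‖ := by
  refine ⟨‖(memLp_inv_weight hr).toLp _‖, norm_nonneg _, fun u hu x => ?_⟩
  rw [rep_eq_inner hr hu]
  refine (norm_inner_le_norm _ _).trans (mul_le_mul_of_nonneg_right ?_ (norm_nonneg _))
  refine Lp.norm_le_norm_of_ae_le ?_
  filter_upwards [(memLp_inv_weight hr).coeFn_toLp, (memLp_evalKernel hr x).coeFn_toLp]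
    with ξ h1 h2
  rw [h1, h2, norm_mul, Complex.norm_exp_ofReal_mul_I, one_mul]

lemma ae_norm_le {r : ℝ} (hr : 1 / 2 < r) {u : L2} (hu : u ∈ sobolev r) :
    ∃ B, 0 < B ∧ ∀ᵐ x, ‖u x‖ ≤ B := by
  obtain ⟨C, hC0, hC⟩ := exists_norm_rep_le hr
  refine ⟨C * ‖weighted hu‖ + 1, by positivity, ?_⟩
  filter_upwards [rep_ae hr hu] with x hx
  rw [hx]; linarith [hC u hu x]

lemma norm_weighted_sq {r : ℝ} {u : L2} (hu : u ∈ sobolev r) :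
    ‖weighted hu‖ ^ 2 = ∫ ξ, weight r ξ ^ 2 * ‖(𝓕 u : L2) ξ‖ ^ 2 := by
  rw [← mass_eq_norm_sq]
  refine integral_congr_ae ?_
  filter_upwards [weighted_ae hu] with ξ h
  rw [h, norm_mul, Complex.norm_real, Real.norm_eq_abs, abs_of_pos (weight_pos r ξ)]; ring

lemma integrable_norm_rpow {u : L2} {p : ℝ} (hp : 2 ≤ p) {B : ℝ}
    (hB : ∀ᵐ x, ‖u x‖ ≤ B) : Integrable (fun x => ‖u x‖ ^ p) := by
  have h2 : Integrable (fun x => ‖u x‖ ^ 2) := (Lp.memLp u).integrable_norm_pow (by norm_num)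
  refine (h2.const_mul (B ^ (p - 2))).mono'
    (((Lp.aestronglyMeasurable u).norm.aemeasurable.pow_const p).aestronglyMeasurable) ?_
  filter_upwards [hB] with x hx
  rw [Real.norm_of_nonneg (by positivity)]
  rcases eq_or_lt_of_le (norm_nonneg (u x)) with h | h
  · rw [← h, Real.zero_rpow (by linarith)]; simp
  · calc ‖u x‖ ^ p = ‖u x‖ ^ (p - 2) * ‖u x‖ ^ 2 := by
          rw [← Real.rpow_natCast, ← Real.rpow_add h]; congr 1; push_cast; ring
      _ ≤ _ := by gcongr

lemma potential_nonneg (s : ℝ) (u : L2) : 0 ≤ potential s u :=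
  integral_nonneg fun x => by positivity

lemma potential_pos {s : ℝ} (hs : 1 < s) {u : L2} (hu : u ∈ sobolev (s / 2)) (h0 : u ≠ 0) :
    0 < potential s u := by
  obtain ⟨B, -, hB⟩ := ae_norm_le (by linarith) hu
  refine lt_of_le_of_ne (potential_nonneg s u) fun h => h0 ?_
  have h1 := (integral_eq_zero_iff_of_nonneg (fun x => by positivity)
    (integrable_norm_rpow (by linarith : 2 ≤ 2 * s + 2) hB)).1 h.symm
  rw [Lp.eq_zero_iff_ae_eq_zero]
  filter_upwards [h1] with x hx
  have := (Real.rpow_eq_zero (norm_nonneg (u x)) (by linarith)).1 hx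
  simpa using this

/-! ### First variation and the Euler-Lagrange equation. -/

lemma mem_sobolev_zero (u : L2) : u ∈ sobolev 0 := by
  rw [mem_sobolev_iff]
  refine (Lp.memLp (𝓕 u : L2)).ae_eq (Filter.Eventually.of_forall fun ξ => ?_)
  simp [weight]

lemma bilForm_one_eq (u v : L2) : bilForm (fun _ => 1) u v = ∫ x, inner ℝ (u x) (v x) := by
  have key : ∀ f g : L2, (inner ℂ f g : ℂ).re = ∫ x, inner ℝ (f x) (g x) := by
    intro f g
    rw [L2.inner_def]
    exact (integral_re (𝕜 := ℂ) (L2.integrable_inner (𝕜 := ℂ) f g)).symm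
  unfold bilForm
  simp only [one_mul]
  rw [← key, ← key, Lp.inner_fourier_eq]

lemma quadForm_one (u : L2) : quadForm (fun _ => 1) u = mass u := by
  rw [quadForm_const, one_mul]

lemma hasDerivAt_norm_add_mul_rpow {p : ℝ} (hp : 1 < p) (a b : ℂ) (t : ℝ) :
    HasDerivAt (fun t : ℝ => ‖a + t * b‖ ^ p)
      (p * ‖a + t * b‖ ^ (p - 2) * inner ℝ (a + t * b) b) t := by
  have h1 : HasDerivAt (fun t : ℝ => a + t * b) b t := by
    have := ((Complex.ofRealCLM.hasDerivAt (x := t)).mul_const b).const_add a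
    simpa using this
  have h2 := (hasFDerivAt_norm_rpow (a + t * b) hp).comp_hasDerivAt t h1
  refine h2.congr_deriv ?_
  simp only [smul_apply, innerSL_apply_apply, smul_eq_mul]

/-- Differentiation under the integral. The sup bounds reduce the derivative to (2B)^{2s} times a
product of two L² functions, which is an integrable majorant for |t| < 1. -/
lemma hasDerivAt_potential {s : ℝ} (hs : 0 < s) {u φ : L2} {B : ℝ}
    (hu : ∀ᵐ x, ‖u x‖ ≤ B) (hφ : ∀ᵐ x, ‖φ x‖ ≤ B) :
    HasDerivAt (fun t : ℝ => potential s (u + (t : ℂ) • φ))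
      ((2 * s + 2) * ∫ x, ‖u x‖ ^ (2 * s) * inner ℝ (u x) (φ x)) 0 := by
  have hB : 0 ≤ B := by
    obtain ⟨x, hx⟩ := hu.exists
    exact (norm_nonneg _).trans hx
  have hfun : (fun t : ℝ => potential s (u + (t : ℂ) • φ)) =
      fun t : ℝ => ∫ x, ‖u x + t * φ x‖ ^ (2 * s + 2) := by
    ext t
    refine integral_congr_ae ?_
    filter_upwards [Lp.coeFn_add u ((t : ℂ) • φ), Lp.coeFn_smul (t : ℂ) φ] with x h1 h2
    rw [h1, Pi.add_apply, h2]; rfl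
  have hum := Lp.aestronglyMeasurable u
  have hφm := Lp.aestronglyMeasurable φ
  have hmeas : ∀ t : ℝ, AEStronglyMeasurable (fun x => u x + t * φ x) volume := fun t =>
    hum.add (hφm.const_mul (t : ℂ))
  have hpow : ∀ (t q : ℝ), AEStronglyMeasurable (fun x => ‖u x + t * φ x‖ ^ q) volume :=
    fun t q => ((hmeas t).norm.aemeasurable.pow_const q).aestronglyMeasurable
  have hmain := hasDerivAt_integral_of_dominated_loc_of_deriv_le (μ := volume) (𝕜 := ℝ)
    (F := fun t x => ‖u x + t * φ x‖ ^ (2 * s + 2))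
    (F' := fun t x => (2 * s + 2) * ‖u x + t * φ x‖ ^ (2 * s + 2 - 2) *
      inner ℝ (u x + t * φ x) (φ x))
    (bound := fun x => (2 * s + 2) * (2 * B) ^ (2 * s) * ((‖u x‖ + ‖φ x‖) * ‖φ x‖))
    (x₀ := 0) (s := Metric.ball 0 1) (Metric.ball_mem_nhds _ one_pos)
    (Filter.Eventually.of_forall fun t => hpow t _) ?_ ?_ ?_ ?_ ?_
  · rw [hfun]
    refine hmain.2.congr_deriv ?_
    rw [← integral_const_mul]
    congr 1; ext x
    rw [show 2 * s + 2 - 2 = 2 * s by ring]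
    simp only [Complex.ofReal_zero, zero_mul, add_zero]; ring
  · simpa using integrable_norm_rpow (by linarith : 2 ≤ 2 * s + 2) hu
  · exact ((hpow 0 _).const_mul _).mul ((hmeas 0).inner hφm)
  · filter_upwards [hu, hφ] with x h1 h2 t ht
    have ht' : |t| ≤ 1 := by simpa using (Metric.mem_ball.1 ht).le
    have h3 : ‖u x + t * φ x‖ ≤ ‖u x‖ + ‖φ x‖ := by
      refine (norm_add_le _ _).trans ?_
      rw [norm_mul, Complex.norm_real, Real.norm_eq_abs]
      nlinarith [norm_nonneg (φ x)]
    rw [norm_mul, norm_mul, Real.norm_of_nonneg (by linarith : 0 ≤ 2 * s + 2),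
      Real.norm_of_nonneg (by positivity), mul_assoc, mul_assoc]
    refine mul_le_mul_of_nonneg_left (mul_le_mul ?_ ?_ (norm_nonneg _) (by positivity))
      (by linarith)
    · rw [show 2 * s + 2 - 2 = 2 * s by ring]
      exact Real.rpow_le_rpow (norm_nonneg _) (by linarith) (by linarith)
    · exact (norm_inner_le_norm _ _).trans (mul_le_mul_of_nonneg_right h3 (norm_nonneg _))
  · exact (((Lp.memLp u).norm.add (Lp.memLp φ).norm).integrable_mul (Lp.memLp φ).norm).const_mul _
  · exact Filter.Eventually.of_forall fun x t _ =>
      hasDerivAt_norm_add_mul_rpow (by linarith) _ _ _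

lemma hasDerivAt_quadForm {r : ℝ} {m : ℝ → ℝ} (hm : IsSymbol r m) {u φ : L2}
    (hu : u ∈ sobolev r) (hφ : φ ∈ sobolev r) :
    HasDerivAt (fun t : ℝ => quadForm m (u + (t : ℂ) • φ)) (2 * bilForm m u φ) 0 := by
  have : (fun t : ℝ => quadForm m (u + (t : ℂ) • φ)) =
      fun t : ℝ => quadForm m u + 2 * (t * bilForm m u φ) + t ^ 2 * quadForm m φ := by
    ext t
    rw [quadForm_add hm hu (smul_mem_sobolev _ hφ), bilForm_real_smul, quadForm_smul]
    simp
  rw [this]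
  have h1 := (((hasDerivAt_id (0 : ℝ)).mul_const (bilForm m u φ)).const_mul 2).const_add
    (quadForm m u)
  have h2 := ((hasDerivAt_id (0 : ℝ)).pow 2).mul_const (quadForm m φ)
  exact (h1.add h2).congr_deriv (by simp)

/-- Boundedness of u is what lets the travelling wave equation be read in L² rather than in a dual
space. -/
lemma memLp_nonlinearity {s : ℝ} (hs : 0 < s) {u : L2} {B : ℝ} (hu : ∀ᵐ x, ‖u x‖ ≤ B) :
    MemLp (fun x => u x * ((‖u x‖ ^ (2 * s) : ℝ) : ℂ)) 2 volume := by
  have hum := Lp.aestronglyMeasurable u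
  refine ((Lp.memLp u).const_mul ((B ^ (2 * s) : ℝ) : ℂ)).mono ?_ ?_
  · exact hum.mul (Complex.continuous_ofReal.comp_aestronglyMeasurable
      (hum.norm.aemeasurable.pow_const _).aestronglyMeasurable)
  · filter_upwards [hu] with x hx
    rw [norm_mul, norm_mul, mul_comm, Complex.norm_real, Complex.norm_real]
    have h0 := norm_nonneg (u x)
    rw [Real.norm_of_nonneg (by positivity), Real.norm_of_nonneg (by
      have := h0.trans hx; positivity)]
    exact mul_le_mul_of_nonneg_right (Real.rpow_le_rpow h0 hx (by linarith)) h0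

/-- A function which is orthogonal to all band-limited `L²` functions vanishes. -/
lemma ae_eq_zero_of_truncation_orthogonal {h : ℝ → ℂ} {g : ℝ → ℝ → ℂ}
    (hg : ∀ R : ℕ, g R = (Set.Icc (-(R : ℝ)) R).indicator h)
    (hL : ∀ R : ℕ, MemLp (g R) 2 volume)
    (h0 : ∀ R : ℕ, ∫ ξ, inner ℝ (h ξ) (g R ξ) = 0) : h =ᵐ[volume] 0 := by
  have key : ∀ R : ℕ, ∀ᵐ ξ, g R ξ = 0 := by
    intro R
    have h1 : ∀ ξ, inner ℝ (h ξ) (g R ξ) = ‖g R ξ‖ ^ 2 := by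
      intro ξ
      rw [hg R]
      by_cases hξ : ξ ∈ Set.Icc (-(R : ℝ)) R
      · rw [Set.indicator_of_mem hξ, real_inner_self_eq_norm_sq]
      · simp [Set.indicator_of_notMem hξ]
    have h2 := h0 R
    simp_rw [h1] at h2
    have h3 := (integral_eq_zero_iff_of_nonneg (fun ξ => by positivity)
      ((hL R).integrable_norm_pow (by norm_num))).1 h2
    filter_upwards [h3] with ξ hξ
    simpa using hξ
  filter_upwards [ae_all_iff.2 key] with ξ hξ
  obtain ⟨R, hR⟩ := exists_nat_ge |ξ|
  have := hξ R
  rwa [hg R, Set.indicator_of_mem (Set.mem_Icc.2 (abs_le.1 hR))] at this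

/-- The Euler-Lagrange equation of a nonnegative functional
`a (∫ v̄ m(D) v) (∫ |v|²)^s - b ∫ |v|^{2s+2} - e (∫ |v|²)^{s+1}` at a zero `u`. -/
lemma euler_lagrange {s r : ℝ} (hs : 0 < s) (hr : 1 / 2 < r) {m : ℝ → ℝ} (hm : IsSymbol r m)
    {u : L2} (hu : u ∈ sobolev r) (hu0 : u ≠ 0) {a b e : ℝ}
    (hnonneg : ∀ v ∈ sobolev r,
      0 ≤ a * (quadForm m v * mass v ^ s) - b * potential s v - e * mass v ^ (s + 1))
    (hzero : a * (quadForm m u * mass u ^ s) - b * potential s u - e * mass u ^ (s + 1) = 0)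
    {f : L2} (hf : f =ᵐ[volume] fun x => u x * ((‖u x‖ ^ (2 * s) : ℝ) : ℂ)) :
    ∀ᵐ ξ, ((a * mass u ^ s * m (2 * Real.pi * ξ) +
        (a * quadForm m u * s * mass u ^ (s - 1) - e * (s + 1) * mass u ^ s) : ℝ) : ℂ) *
        (𝓕 u : L2) ξ - ((b * (s + 1) : ℝ) : ℂ) * (𝓕 f : L2) ξ = 0 := by
  set κ := a * quadForm m u * s * mass u ^ (s - 1) - e * (s + 1) * mass u ^ s with hκ
  have hM := mass_pos hu0
  have hone : IsSymbol r (fun _ => (1 : ℝ)) := isSymbol_const (by linarith) 1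
  -- the first variation
  have hvar : ∀ φ ∈ sobolev r, a * mass u ^ s * bilForm m u φ + κ * bilForm (fun _ => 1) u φ
      - b * (s + 1) * bilForm (fun _ => 1) f φ = 0 := by
    intro φ hφ
    obtain ⟨B₁, h1, hB₁⟩ := ae_norm_le hr hu
    obtain ⟨B₂, h2, hB₂⟩ := ae_norm_le hr hφ
    have dP := hasDerivAt_potential hs (B := B₁ + B₂)
      (hB₁.mono fun x hx => by linarith) (hB₂.mono fun x hx => by linarith)
    have dQ := hasDerivAt_quadForm hm hu hφ
    have dM := hasDerivAt_quadForm hone hu hφ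
    simp_rw [quadForm_one] at dM
    have hu' : u + ((0 : ℝ) : ℂ) • φ = u := by simp
    have dMs := dM.rpow_const (p := s) (Or.inl (by rw [hu']; exact hM.ne'))
    have dMs1 := dM.rpow_const (p := s + 1) (Or.inl (by rw [hu']; exact hM.ne'))
    have dG := (((dQ.mul dMs).const_mul a).sub (dP.const_mul b)).sub (dMs1.const_mul e)
    -- The functional is nonnegative and vanishes at u, so t = 0 is a minimum along every line
    -- through u and no multiplier is needed.
    have hmin : IsLocalMin (fun t : ℝ =>
        a * (quadForm m (u + (t : ℂ) • φ) * mass (u + (t : ℂ) • φ) ^ s)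
        - b * potential s (u + (t : ℂ) • φ) - e * mass (u + (t : ℂ) • φ) ^ (s + 1)) 0 := by
      refine Filter.Eventually.of_forall fun t => ?_
      simp only [hu', hzero]
      exact hnonneg _ (add_mem_sobolev hu (smul_mem_sobolev _ hφ))
    have hd := hmin.hasDerivAt_eq_zero dG
    rw [hu'] at hd
    -- Plancherel moves the nonlinear term to the Fourier side, where the other two terms already
    -- live.
    have hF : ∫ x, ‖u x‖ ^ (2 * s) * inner ℝ (u x) (φ x) = bilForm (fun _ => 1) f φ := by
      rw [bilForm_one_eq]
      refine integral_congr_ae ?_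
      filter_upwards [hf] with x hx
      rw [hx, mul_comm (u x)]
      have : ((‖u x‖ ^ (2 * s) : ℝ) : ℂ) * u x = (‖u x‖ ^ (2 * s)) • u x := by simp
      rw [this, real_inner_smul_left]
    rw [hF, show s + 1 - 1 = s by ring] at hd
    rw [hκ]
    linarith
  -- test with truncations
  set h : ℝ → ℂ := fun ξ => ((a * mass u ^ s * m (2 * Real.pi * ξ) + κ : ℝ) : ℂ) *
    (𝓕 u : L2) ξ - ((b * (s + 1) : ℝ) : ℂ) * (𝓕 f : L2) ξ with hh
  have hmeas : AEStronglyMeasurable h volume := by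
    refine AEStronglyMeasurable.sub ?_ ((Lp.aestronglyMeasurable _).const_mul _)
    refine AEStronglyMeasurable.mul ?_ (Lp.aestronglyMeasurable _)
    exact Complex.continuous_ofReal.comp_aestronglyMeasurable
      (((aestronglyMeasurable_symbol hm.1).const_mul _).add aestronglyMeasurable_const)
  obtain ⟨C, hC⟩ := hm.2
  -- On a bounded frequency interval the weight and the symbol are bounded, so the truncation of h
  -- is the transform of an H^r function.
  have hbound : ∀ R : ℕ, ∃ K : ℝ, ∀ ξ ∈ Set.Icc (-(R : ℝ)) R,
      weight r ξ * ‖h ξ‖ ≤ K * (‖(𝓕 u : L2) ξ‖ + ‖(𝓕 f : L2) ξ‖) := by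
    intro R
    obtain ⟨D, hD⟩ := (isCompact_Icc (a := -(R : ℝ)) (b := R)).exists_bound_of_continuousOn
      (continuous_weight r).continuousOn
    have hD1 : ∀ ξ ∈ Set.Icc (-(R : ℝ)) R, weight r ξ ≤ D := fun ξ hξ =>
      (le_abs_self _).trans (hD ξ hξ)
    refine ⟨D * ((|a * mass u ^ s| * (|C| * D ^ 2) + |κ|) + |b * (s + 1)|), fun ξ hξ => ?_⟩
    have hw := weight_pos r ξ
    have hwD := hD1 ξ hξ
    rw [mul_assoc]
    refine mul_le_mul hwD ?_ (norm_nonneg _) (hw.le.trans hwD)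
    refine (norm_sub_le _ _).trans ?_
    rw [norm_mul, norm_mul, Complex.norm_real, Complex.norm_real, Real.norm_eq_abs,
      Real.norm_eq_abs]
    have h1 : |m (2 * Real.pi * ξ)| ≤ |C| * D ^ 2 := by
      refine (hC ξ).trans ?_
      refine (mul_le_mul_of_nonneg_right (le_abs_self C) (by positivity)).trans ?_
      gcongr
    have h2 : |a * mass u ^ s * m (2 * Real.pi * ξ) + κ| ≤
        |a * mass u ^ s| * (|C| * D ^ 2) + |κ| := by
      refine (abs_add_le _ _).trans (add_le_add_left ?_ _)
      rw [abs_mul]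
      exact mul_le_mul_of_nonneg_left h1 (abs_nonneg _)
    have h3 := mul_le_mul_of_nonneg_right h2 (norm_nonneg ((𝓕 u : L2) ξ))
    have h4 : 0 ≤ (|a * mass u ^ s| * (|C| * D ^ 2) + |κ|) * ‖(𝓕 f : L2) ξ‖ := by positivity
    have h5 : 0 ≤ |b * (s + 1)| * ‖(𝓕 u : L2) ξ‖ := by positivity
    nlinarith
  have hwL : ∀ R : ℕ, MemLp (fun ξ => (weight r ξ : ℂ) *
      (Set.Icc (-(R : ℝ)) R).indicator h ξ) 2 volume := by
    intro R
    obtain ⟨K, hK⟩ := hbound R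
    refine (((Lp.memLp (𝓕 u : L2)).norm.add (Lp.memLp (𝓕 f : L2)).norm).const_mul K).mono ?_ ?_
    · exact (Complex.continuous_ofReal.comp (continuous_weight r)).aestronglyMeasurable.mul
        (hmeas.indicator measurableSet_Icc)
    · refine Filter.Eventually.of_forall fun ξ => ?_
      by_cases hξ : ξ ∈ Set.Icc (-(R : ℝ)) R
      · rw [Set.indicator_of_mem hξ, norm_mul, Complex.norm_real, Real.norm_eq_abs,
          abs_of_pos (weight_pos r ξ)]
        exact (hK ξ hξ).trans (le_abs_self _)
      · rw [Set.indicator_of_notMem hξ, mul_zero, norm_zero]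
        exact norm_nonneg _
  have hL : ∀ R : ℕ, MemLp ((Set.Icc (-(R : ℝ)) R).indicator h) 2 volume := by
    intro R
    refine (hwL R).mono (hmeas.indicator measurableSet_Icc)
      (Filter.Eventually.of_forall fun ξ => ?_)
    rw [norm_mul, Complex.norm_real, Real.norm_eq_abs, abs_of_pos (weight_pos r ξ)]
    exact le_mul_of_one_le_left (norm_nonneg _) (one_le_weight (by linarith) ξ)
  refine ae_eq_zero_of_truncation_orthogonal
    (g := fun R => (Set.Icc (-R) R).indicator h) (fun R => rfl) hL fun R => ?_
  -- With this test function the first variation becomes the integral of ‖h‖² over [-R, R].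
  set φ : L2 := 𝓕⁻ ((hL R).toLp _) with hφdef
  have hφF : (𝓕 φ : L2) =ᵐ[volume] (Set.Icc (-(R : ℝ)) R).indicator h := by
    rw [hφdef, FourierTransform.fourier_fourierInv_eq]
    exact (hL R).coeFn_toLp
  have hφ : φ ∈ sobolev r := by
    rw [mem_sobolev_iff]
    refine (hwL R).ae_eq ?_
    filter_upwards [hφF] with ξ hξ
    rw [hξ]
  rw [← hvar φ hφ]
  unfold bilForm
  have i1 := integrable_bilForm hm hu hφ
  have i2 := integrable_bilForm hone hu hφ
  have i3 := integrable_bilForm (isSymbol_const le_rfl 1) (mem_sobolev_zero f) (mem_sobolev_zero φ)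
  rw [← integral_const_mul, ← integral_const_mul, ← integral_const_mul,
    ← integral_add (i1.const_mul _) (i2.const_mul _)]
  refine Eq.trans ?_ (integral_sub
    ((i1.const_mul (a * mass u ^ s)).add (i2.const_mul κ)) (i3.const_mul (b * (s + 1))))
  refine integral_congr_ae ?_
  filter_upwards [hφF] with ξ hξ
  rw [← hξ]
  rw [inner_sub_left, ← Complex.real_smul, ← Complex.real_smul, real_inner_smul_left,
    real_inner_smul_left]
  ring

/-! ### The Brezis-Lieb lemma. -/

/-- Convexity of the power function: Bernoulli's inequality at y/x is the tangent line bound at x.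
-/
lemma rpow_sub_rpow_le {p : ℝ} (hp : 1 ≤ p) {x y : ℝ} (hx : 0 ≤ x) (hy : 0 ≤ y) :
    x ^ p - y ^ p ≤ p * x ^ (p - 1) * (x - y) := by
  rcases hx.eq_or_lt with rfl | hx
  · rw [Real.zero_rpow (by linarith)]
    rcases eq_or_lt_of_le hp with rfl | hp'
    · simp
    · rw [Real.zero_rpow (by linarith)]
      have := Real.rpow_nonneg hy p
      linarith
  · have h := one_add_mul_self_le_rpow_one_add (s := y / x - 1)
      (by have := div_nonneg hy hx.le; linarith) hp
    rw [show 1 + (y / x - 1) = y / x by ring, Real.div_rpow hy hx.le,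
      le_div_iff₀ (Real.rpow_pos_of_pos hx p)] at h
    have h2 : x ^ p = x ^ (p - 1) * x := by
      rw [← Real.rpow_add_one hx.ne']; congr 1; ring
    have h3 : (1 + p * (y / x - 1)) * x ^ p = x ^ p + p * x ^ (p - 1) * (y - x) := by
      rw [h2]; field_simp
    linarith

/-- The uniform bound B trades p-th powers for squares: convexity gives C(‖a‖ + ‖b‖)‖a‖ for the
first difference, and Young's inequality puts only a small multiple on ‖b‖². In the Brezis-Lieb
lemma b is the oscillating part, bounded in L², and a is the fixed limit. -/
lemma abs_norm_rpow_sub_le {p : ℝ} (hp : 2 ≤ p) {B ε : ℝ} (hε : 0 < ε) {a b : ℂ}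
    (ha : ‖a‖ ≤ B) (hb : ‖b‖ ≤ B) :
    |‖a + b‖ ^ p - ‖b‖ ^ p - ‖a‖ ^ p| ≤ ε * ‖b‖ ^ 2 +
      ((p * (2 * B) ^ (p - 2)) ^ 2 / (4 * ε) + 2 * (p * (2 * B) ^ (p - 2))) * ‖a‖ ^ 2 := by
  set C := p * (2 * B) ^ (p - 2) with hC
  have hB : 0 ≤ B := (norm_nonneg a).trans ha
  have hC0 : 0 ≤ C := by positivity
  set S := ‖a‖ + ‖b‖ with hS
  have hS0 : 0 ≤ S := by positivity
  have hpow : ∀ x : ℝ, 0 ≤ x → x ≤ S → p * x ^ (p - 1) ≤ C * S := by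
    intro x hx hxS
    rw [hC, mul_assoc]
    refine mul_le_mul_of_nonneg_left ?_ (by linarith)
    rcases hx.eq_or_lt with rfl | hx'
    · rw [Real.zero_rpow (by linarith)]; positivity
    · have : x ^ (p - 1) = x ^ (p - 2) * x := by
        rw [← Real.rpow_add_one hx'.ne']; congr 1; ring
      rw [this]
      exact mul_le_mul (Real.rpow_le_rpow hx (by linarith) (by linarith)) hxS hx (by positivity)
  have hab : ‖a + b‖ ≤ S := norm_add_le _ _
  have h1 : |‖a + b‖ ^ p - ‖b‖ ^ p| ≤ C * S * ‖a‖ := by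
    have e1 := rpow_sub_rpow_le (by linarith : 1 ≤ p) (norm_nonneg (a + b)) (norm_nonneg b)
    have e2 := rpow_sub_rpow_le (by linarith : 1 ≤ p) (norm_nonneg b) (norm_nonneg (a + b))
    have f1 := hpow _ (norm_nonneg (a + b)) hab
    have f2 := hpow _ (norm_nonneg b) (by rw [hS]; linarith [norm_nonneg a])
    have g1 : ‖a + b‖ - ‖b‖ ≤ ‖a‖ := by linarith
    have g2 : ‖b‖ - ‖a + b‖ ≤ ‖a‖ := by
      have := norm_sub_norm_le b (-a)
      rw [sub_neg_eq_add, norm_neg, add_comm b a] at this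
      have h3 := norm_sub_le (a + b) a
      rw [add_sub_cancel_left] at h3
      linarith
    have n1 : 0 ≤ p * ‖a + b‖ ^ (p - 1) := by positivity
    have n2 : 0 ≤ p * ‖b‖ ^ (p - 1) := by positivity
    have k1 := mul_le_mul_of_nonneg_left g1 n1
    have k2 := mul_le_mul_of_nonneg_left g2 n2
    have l1 := mul_le_mul_of_nonneg_right f1 (norm_nonneg a)
    have l2 := mul_le_mul_of_nonneg_right f2 (norm_nonneg a)
    rw [abs_le]; constructor <;> linarith
  have h2 : ‖a‖ ^ p ≤ C * ‖a‖ ^ 2 := by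
    have e1 := rpow_sub_rpow_le (by linarith : 1 ≤ p) (norm_nonneg a) le_rfl
    rw [Real.zero_rpow (by linarith), sub_zero, sub_zero] at e1
    refine e1.trans ?_
    have : p * ‖a‖ ^ (p - 1) ≤ C * ‖a‖ := by
      rw [hC, mul_assoc]
      refine mul_le_mul_of_nonneg_left ?_ (by linarith)
      rcases (norm_nonneg a).eq_or_lt with h | hx'
      · rw [← h, Real.zero_rpow (by linarith)]; simp
      · have : ‖a‖ ^ (p - 1) = ‖a‖ ^ (p - 2) * ‖a‖ := by
          rw [← Real.rpow_add_one hx'.ne']; congr 1; ring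
        rw [this]
        gcongr; linarith
    nlinarith [norm_nonneg a]
  have h3 : |‖a + b‖ ^ p - ‖b‖ ^ p - ‖a‖ ^ p| ≤ C * S * ‖a‖ + C * ‖a‖ ^ 2 := by
    refine (abs_sub _ _).trans ?_
    rw [abs_of_nonneg (by positivity : 0 ≤ ‖a‖ ^ p)]
    exact add_le_add h1 h2
  refine h3.trans ?_
  have h4 : C * ‖a‖ * ‖b‖ ≤ ε * ‖b‖ ^ 2 + C ^ 2 / (4 * ε) * ‖a‖ ^ 2 := by
    have : 0 ≤ (2 * ε * ‖b‖ - C * ‖a‖) ^ 2 / (4 * ε) := by positivity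
    have e : (2 * ε * ‖b‖ - C * ‖a‖) ^ 2 / (4 * ε) =
        ε * ‖b‖ ^ 2 + C ^ 2 / (4 * ε) * ‖a‖ ^ 2 - C * ‖a‖ * ‖b‖ := by
      field_simp; ring
    linarith
  rw [hS]
  nlinarith

/-- The Brezis-Lieb lemma for uniformly bounded sequences of `L²` functions. -/
lemma brezis_lieb {α : Type*} [MeasurableSpace α] {μ : Measure α} {p : ℝ} (hp : 2 ≤ p) {B K : ℝ}
    {f : α → ℂ} {g : ℕ → α → ℂ} (hf : MemLp f 2 μ) (hg : ∀ n, MemLp (g n) 2 μ)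
    (hfB : ∀ᵐ x ∂μ, ‖f x‖ ≤ B) (hgB : ∀ n, ∀ᵐ x ∂μ, ‖g n x‖ ≤ B)
    (hg0 : ∀ᵐ x ∂μ, Filter.Tendsto (fun n => g n x) Filter.atTop (nhds 0))
    (hK : ∀ n, ∫ x, ‖g n x‖ ^ 2 ∂μ ≤ K) :
    Filter.Tendsto (fun n => ∫ x, (‖f x + g n x‖ ^ p - ‖g n x‖ ^ p - ‖f x‖ ^ p) ∂μ)
      Filter.atTop (nhds 0) := by
  set D : ℕ → α → ℝ := fun n x => ‖f x + g n x‖ ^ p - ‖g n x‖ ^ p - ‖f x‖ ^ p with hD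
  have hDm : ∀ n, AEStronglyMeasurable (D n) μ := fun n =>
    ((((hf.1.add (hg n).1).norm.aemeasurable.pow_const p).sub
      ((hg n).1.norm.aemeasurable.pow_const p)).sub
      (hf.1.norm.aemeasurable.pow_const p)).aestronglyMeasurable
  have hf2 : Integrable (fun x => ‖f x‖ ^ 2) μ := hf.integrable_norm_pow (by norm_num)
  have hg2 : ∀ n, Integrable (fun x => ‖g n x‖ ^ 2) μ := fun n =>
    (hg n).integrable_norm_pow (by norm_num)
  have hK0 : 0 ≤ K := (integral_nonneg fun x => by positivity).trans (hK 0)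
  rw [Metric.tendsto_atTop]
  intro δ hδ
  -- This makes ε K < δ/2, leaving δ/2 for the part treated by dominated convergence.
  set ε := δ / (2 * (K + 1)) with hε
  have hε0 : 0 < ε := by positivity
  set C := (p * (2 * B) ^ (p - 2)) ^ 2 / (4 * ε) + 2 * (p * (2 * B) ^ (p - 2)) with hC
  have hbd : ∀ n, ∀ᵐ x ∂μ, |D n x| ≤ ε * ‖g n x‖ ^ 2 + C * ‖f x‖ ^ 2 := by
    intro n
    filter_upwards [hfB, hgB n] with x h1 h2
    exact abs_norm_rpow_sub_le hp hε0 h1 h2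
  -- Subtracting ε‖g n‖² leaves a positive part dominated by C‖f‖², independently of n, although the
  -- defect `D n` itself need not have such a majorant.
  have hlim : Filter.Tendsto (fun n => ∫ x, max (|D n x| - ε * ‖g n x‖ ^ 2) 0 ∂μ)
      Filter.atTop (nhds (∫ _, 0 ∂μ)) := by
    refine tendsto_integral_of_dominated_convergence (fun x => C * ‖f x‖ ^ 2)
      (fun n => (((hDm n).norm.sub ((hg2 n).1.const_mul ε)).sup aestronglyMeasurable_const))
      (hf2.const_mul C) (fun n => ?_) ?_
    · filter_upwards [hbd n, hfB] with x hx hfx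
      rw [Real.norm_of_nonneg (le_max_right _ _)]
      have hB : 0 ≤ B := (norm_nonneg _).trans hfx
      refine max_le (by linarith) ?_
      have : 0 ≤ C := by positivity
      positivity
    · filter_upwards [hg0] with x hx
      have hp0 : 0 < p := by linarith
      have h1 : Filter.Tendsto (fun n => D n x) Filter.atTop (nhds 0) := by
        have t1 := ((hx.const_add (f x)).norm).rpow_const (p := p) (Or.inr hp0.le)
        have t2 := hx.norm.rpow_const (p := p) (Or.inr hp0.le)
        have := (t1.sub t2).sub_const (‖f x‖ ^ p)
        simpa [Real.zero_rpow hp0.ne'] using this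
      have h2 := ((h1.abs.sub ((hx.norm.pow 2).const_mul ε)).max
        (tendsto_const_nhds (x := (0 : ℝ))))
      simpa using h2
  rw [integral_zero] at hlim
  obtain ⟨n₀, hn₀⟩ := Metric.tendsto_atTop.1 hlim (δ / 2) (by positivity)
  refine ⟨n₀, fun n hn => ?_⟩
  have h1 := hn₀ n hn
  rw [Real.dist_eq, sub_zero] at h1 ⊢
  have hDi : Integrable (D n) μ :=
    (((hg2 n).const_mul ε).add (hf2.const_mul C)).mono' (hDm n) (hbd n)
  have h2 : |∫ x, D n x ∂μ| ≤ ∫ x, |D n x| ∂μ := abs_integral_le_integral_abs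
  have hmi : Integrable (fun x => max (|D n x| - ε * ‖g n x‖ ^ 2) 0) μ :=
    (hDi.abs.sub ((hg2 n).const_mul ε)).pos_part
  have h3 : ∫ x, |D n x| ∂μ ≤
      ∫ x, (max (|D n x| - ε * ‖g n x‖ ^ 2) 0 + ε * ‖g n x‖ ^ 2) ∂μ := by
    refine integral_mono hDi.abs (hmi.add ((hg2 n).const_mul ε)) fun x => ?_
    have := le_max_left (|D n x| - ε * ‖g n x‖ ^ 2) 0
    simp only
    linarith
  rw [integral_add hmi ((hg2 n).const_mul ε), integral_const_mul] at h3
  have h4 : ε * ∫ x, ‖g n x‖ ^ 2 ∂μ ≤ ε * K := mul_le_mul_of_nonneg_left (hK n) hε0.le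
  have h5 : ε * K < δ / 2 := by
    have : ε * (K + 1) = δ / 2 := by rw [hε]; field_simp
    linarith
  have h6 := le_abs_self (∫ x, max (|D n x| - ε * ‖g n x‖ ^ 2) 0 ∂μ)
  linarith

/-! ### The sharp Gagliardo-Nirenberg inequality. -/

/-- A ground state satisfies `∫ Q^{2s+2} = (s+1) ∫ Q |D|^s Q`. -/
lemma IsGroundState.potential_eq {s : ℝ} (hs : 1 < s) {Q : L2} (hQ : IsGroundState s Q) :
    potential s Q = (s + 1) * kinetic s Q := by
  obtain ⟨-, ⟨f, hf, heq⟩, hmem, hne, hopt⟩ := hQ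
  have hM := mass_pos hne
  -- Q solves two equations with the same nonlinearity. Eliminating it gives (A|k|^s + B) Q̂ = 0,
  -- where A ≠ 0 if the identity fails; the bracket has at most two zeros, so Q̂ = 0, which is
  -- absurd.
  by_contra hPK
  have hEL := euler_lagrange (s := s) (r := s / 2) (by linarith) (by linarith)
    (isSymbol_abs_rpow (by linarith)) hmem hne
    (a := potential s Q) (b := kinetic s Q * mass Q ^ s) (e := 0)
    (fun v hv => by have := hopt v hv; unfold kinetic at *; linarith)
    (by unfold kinetic; ring) hf
  set M := mass Q
  set K := kinetic s Q with hK
  set P := potential s Q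
  set A := M ^ s * (P - (s + 1) * K) with hA
  set B := P * K * s * M ^ (s - 1) - K * M ^ s * (s + 1) with hB
  have hA0 : A ≠ 0 := mul_ne_zero (Real.rpow_pos_of_pos hM s).ne' (sub_ne_zero.2 hPK)
  have hs0 : s ≠ 0 := by linarith
  have hfin : ({ξ : ℝ | A * |2 * Real.pi * ξ| ^ s + B = 0} : Set ℝ).Finite := by
    refine Set.Finite.subset (s := {(-B / A) ^ s⁻¹ / (2 * Real.pi), -((-B / A) ^ s⁻¹ / (2 * Real.pi))})
      (by simp) ?_
    intro ξ hξ
    have h1 : |2 * Real.pi * ξ| ^ s = -B / A := by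
      rw [eq_div_iff hA0]
      have : A * |2 * Real.pi * ξ| ^ s + B = 0 := hξ
      linarith
    have h2 : |2 * Real.pi * ξ| = (-B / A) ^ s⁻¹ := by
      rw [← h1, Real.rpow_rpow_inv (abs_nonneg _) hs0]
    rw [abs_mul, abs_of_pos (by positivity : 0 < 2 * Real.pi)] at h2
    have h3 : |ξ| = (-B / A) ^ s⁻¹ / (2 * Real.pi) := by
      rw [← h2]; field_simp
    rw [← h3]
    rcases abs_choice ξ with h | h <;> rw [h] <;> simp
  have hQ0 : (𝓕 Q : L2) = 0 := by
    rw [Lp.eq_zero_iff_ae_eq_zero]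
    have hnull : ∀ᵐ ξ : ℝ, ¬ (A * |2 * Real.pi * ξ| ^ s + B = 0) :=
      measure_eq_zero_iff_ae_notMem.1 (hfin.measure_zero volume)
    filter_upwards [hEL, heq, hnull] with ξ h1 h2 h3
    rw [← h2] at h1
    have h4 : ((A * |2 * Real.pi * ξ| ^ s + B : ℝ) : ℂ) * (𝓕 Q : L2) ξ = 0 := by
      rw [← h1, hA, hB, hK]
      unfold kinetic
      push_cast
      ring
    exact (mul_eq_zero.1 h4).resolve_left (by exact_mod_cast h3)
  apply hne
  rw [← FourierTransform.fourierInv_fourier_eq (F := L2) Q, hQ0]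
  exact (Lp.fourierTransformₗᵢ ℝ ℂ).symm.map_zero

lemma kinetic_nonneg (s : ℝ) (u : L2) : 0 ≤ kinetic s u :=
  integral_nonneg fun ξ => mul_nonneg (by positivity) (by positivity)

/-- The sharp Gagliardo-Nirenberg inequality in terms of the mass of the ground state. -/
lemma IsGroundState.gagliardo_nirenberg {s : ℝ} (hs : 1 < s) {Q : L2} (hQ : IsGroundState s Q)
    {v : L2} (hv : v ∈ sobolev (s / 2)) :
    potential s v ≤ (s + 1) * kinetic s v * (mass v / mass Q) ^ s := by
  have hP := hQ.potential_eq hs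
  obtain ⟨-, -, hmem, hne, hopt⟩ := hQ
  have hM := mass_pos hne
  have hPpos := potential_pos hs hmem hne
  have hKpos : 0 < kinetic s Q := by
    by_contra h
    nlinarith
  have h := hopt v hv
  rw [hP] at h
  rw [Real.div_rpow (mass_nonneg v) hM.le, mul_div_assoc', le_div_iff₀ (Real.rpow_pos_of_pos hM s)]
  refine le_of_mul_le_mul_left (a := kinetic s Q) ?_ hKpos
  linarith

/-! ### Gaussian wave packets. -/

lemma sobolev_mono {r r' : ℝ} (h : r ≤ r') {u : L2} (hu : u ∈ sobolev r') : u ∈ sobolev r :=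
  TemperedDistribution.MemSobolev.mono h hu

/-- The Gaussian `A e^{-πb(ξ-ξ₀)²}`. -/
def gaussian (A b ξ₀ ξ : ℝ) : ℝ := A * Real.exp (-Real.pi * b * (ξ - ξ₀) ^ 2)

lemma continuous_gaussian (A b ξ₀ : ℝ) : Continuous (gaussian A b ξ₀) := by
  unfold gaussian; fun_prop

lemma gaussian_sq (A b ξ₀ ξ : ℝ) :
    gaussian A b ξ₀ ξ ^ 2 = A ^ 2 * Real.exp (-(2 * Real.pi * b) * (ξ - ξ₀) ^ 2) := by
  unfold gaussian
  rw [mul_pow, ← Real.exp_nat_mul]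
  congr 2; push_cast; ring

lemma sq_mul_exp_le {c : ℝ} (hc : 0 < c) (y : ℝ) :
    y ^ 2 * Real.exp (-(2 * c) * y ^ 2) ≤ c⁻¹ * Real.exp (-c * y ^ 2) := by
  have h1 : c * y ^ 2 ≤ Real.exp (c * y ^ 2) := by
    linarith [Real.add_one_le_exp (c * y ^ 2)]
  have h2 : Real.exp (-c * y ^ 2) = Real.exp (c * y ^ 2) * Real.exp (-(2 * c) * y ^ 2) := by
    rw [← Real.exp_add]; congr 1; ring
  rw [h2, ← mul_assoc]
  refine mul_le_mul_of_nonneg_right ?_ (Real.exp_nonneg _)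
  rw [inv_mul_eq_div, le_div_iff₀ hc]; linarith

lemma integrable_sq_mul_exp {c : ℝ} (hc : 0 < c) :
    Integrable (fun y : ℝ => y ^ 2 * Real.exp (-(2 * c) * y ^ 2)) := by
  refine ((integrable_exp_neg_mul_sq hc).const_mul c⁻¹).mono'
    (by fun_prop : Continuous fun y : ℝ => y ^ 2 * Real.exp (-(2 * c) * y ^ 2)).aestronglyMeasurable
    (Filter.Eventually.of_forall fun y => ?_)
  rw [Real.norm_of_nonneg (by positivity)]
  exact sq_mul_exp_le hc y

lemma memLp_weight_gaussian {b : ℝ} (hb : 0 < b) (A ξ₀ r : ℝ) (hr : r ≤ 1) :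
    MemLp (fun ξ => (weight r ξ : ℂ) * (gaussian A b ξ₀ ξ : ℂ)) 2 volume := by
  have hm : MemLp (fun ξ => weight r ξ * gaussian A b ξ₀ ξ) 2 volume := by
    have hcont : Continuous fun ξ => weight r ξ * gaussian A b ξ₀ ξ :=
      (continuous_weight r).mul (continuous_gaussian A b ξ₀)
    rw [memLp_two_iff_integrable_sq hcont.aestronglyMeasurable]
    have hc : 0 < Real.pi * b := by positivity
    have i1 := ((integrable_sq_mul_exp hc).comp_sub_right ξ₀).const_mul (2 * A ^ 2)
    have i2 := ((integrable_exp_neg_mul_sq (by positivity : 0 < 2 * (Real.pi * b))).comp_sub_right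
      ξ₀).const_mul ((1 + 2 * ξ₀ ^ 2) * A ^ 2)
    refine (i1.add i2).mono' (hcont.pow 2).aestronglyMeasurable
      (Filter.Eventually.of_forall fun ξ => ?_)
    rw [Real.norm_of_nonneg (by positivity), mul_pow, gaussian_sq, weight_sq, mul_assoc 2]
    have hw : (1 + ξ ^ 2) ^ r ≤ 1 + ξ ^ 2 := by
      conv_rhs => rw [← Real.rpow_one (1 + ξ ^ 2)]
      exact Real.rpow_le_rpow_of_exponent_le (by nlinarith [sq_nonneg ξ]) hr
    have he : 0 ≤ A ^ 2 * Real.exp (-(2 * (Real.pi * b)) * (ξ - ξ₀) ^ 2) := by positivity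
    have h2 : (1 + ξ ^ 2) ^ r ≤ 2 * (ξ - ξ₀) ^ 2 + (1 + 2 * ξ₀ ^ 2) := by
      nlinarith [sq_nonneg (ξ - 2 * ξ₀)]
    have := mul_le_mul_of_nonneg_right h2 he
    simp only [Pi.add_apply]
    linarith
  have := hm.ofReal (K := ℂ)
  simpa using this

/-- Shifting the frequency centre only modulates the function, so the modulus, and with it the
potential term, does not depend on ξ₀. -/
lemma norm_fourierInv_gaussian {b : ℝ} (hb : 0 < b) {A : ℝ} (hA : 0 ≤ A) (ξ₀ x : ℝ) :
    ‖𝓕⁻ (fun ξ => (gaussian A b ξ₀ ξ : ℂ)) x‖ =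
      A * b ^ (-(1 / 2) : ℝ) * Real.exp (-(Real.pi / b) * x ^ 2) := by
  have h1 : (fun ξ : ℝ => (gaussian A b ξ₀ ξ : ℂ)) =
      ((A * Real.exp (-Real.pi * b * ξ₀ ^ 2) : ℝ) : ℂ) • fun ξ : ℝ =>
        Complex.exp (-Real.pi * (b : ℂ) * ξ ^ 2 + 2 * Real.pi * ((b * ξ₀ : ℝ) : ℂ) * ξ) := by
    ext ξ
    simp only [Pi.smul_apply, smul_eq_mul]
    unfold gaussian
    push_cast
    rw [mul_assoc (A : ℂ), ← Complex.exp_add]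
    congr 2; ring
  rw [h1, Real.fourierInv_eq_fourier_neg]
  have h2 := VectorFourier.fourierIntegral_const_smul Real.fourierChar volume (innerₗ ℝ)
    (fun ξ : ℝ => Complex.exp (-Real.pi * (b : ℂ) * ξ ^ 2 + 2 * Real.pi * ((b * ξ₀ : ℝ) : ℂ) * ξ))
    ((A * Real.exp (-Real.pi * b * ξ₀ ^ 2) : ℝ) : ℂ)
  have h3 := fourier_gaussian_pi' (b := (b : ℂ)) (by simpa using hb) ((b * ξ₀ : ℝ) : ℂ)
  have h4 := congr_fun h2 (-x)
  refine (congr_arg norm h4).trans ?_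
  rw [Pi.smul_apply, norm_smul]
  refine (congr_arg (fun z => _ * ‖z‖) (congr_fun h3 (-x))).trans ?_
  rw [norm_mul, Complex.norm_exp, Complex.norm_real, Real.norm_of_nonneg (by positivity), norm_div,
    norm_one]
  have h5 : ‖(b : ℂ) ^ (1 / 2 : ℂ)‖ = b ^ (1 / 2 : ℝ) := by
    rw [Complex.norm_cpow_eq_rpow_re_of_pos hb]; norm_num
  have h6 : (-(Real.pi : ℂ) / b * (((-x : ℝ) : ℂ) + Complex.I * ((b * ξ₀ : ℝ) : ℂ)) ^ 2).re =
      -(Real.pi / b) * x ^ 2 + Real.pi * b * ξ₀ ^ 2 := by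
    have : -(Real.pi : ℂ) / b * (((-x : ℝ) : ℂ) + Complex.I * ((b * ξ₀ : ℝ) : ℂ)) ^ 2 =
        ((-(Real.pi / b) * x ^ 2 + Real.pi * b * ξ₀ ^ 2 : ℝ) : ℂ) +
        ((2 * Real.pi * x * ξ₀ : ℝ) : ℂ) * Complex.I := by
      have hb' : (b : ℂ) ≠ 0 := by exact_mod_cast hb.ne'
      push_cast
      field_simp
      ring_nf
      rw [Complex.I_sq]
      ring
    rw [this, Complex.add_re, Complex.ofReal_re, Complex.re_ofReal_mul, Complex.I_re]; ring
  rw [h5, h6, Real.exp_add, Real.rpow_neg hb.le, one_div]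
  have : Real.exp (-Real.pi * b * ξ₀ ^ 2) * Real.exp (Real.pi * b * ξ₀ ^ 2) = 1 := by
    rw [← Real.exp_add, show -Real.pi * b * ξ₀ ^ 2 + Real.pi * b * ξ₀ ^ 2 = 0 by ring,
      Real.exp_zero]
  linear_combination (A * (b ^ (1 / 2 : ℝ))⁻¹ * Real.exp (-(Real.pi / b) * x ^ 2)) * this

/-- Wave packets concentrated at frequency `k₀` with frequency width `b^{-1/2}`. -/
lemma exists_wave_packet {s N : ℝ} (hs : 0 < s) (hN : 0 < N) (k₀ : ℝ) {b : ℝ} (hb : 0 < b) :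
    ∃ u : L2, u ∈ sobolev 1 ∧ mass u = N ∧
      quadForm (fun k => (k - k₀) ^ 2) u ≤ (4 * Real.pi * Real.sqrt 2 * N) / b ∧
      potential s u = (N * Real.sqrt 2) ^ (s + 1) / Real.sqrt (2 * s + 2) * b ^ (-(s / 2)) := by
  -- Normalization to mass N, since ∫ exp(-2πbξ²) dξ = (2b)^{-1/2}.
  set A := Real.sqrt (N * Real.sqrt (2 * b)) with hAdef
  have hA2 : A ^ 2 = N * Real.sqrt (2 * b) := Real.sq_sqrt (by positivity)
  have hA : 0 ≤ A := Real.sqrt_nonneg _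
  set ξ₀ := k₀ / (2 * Real.pi) with hξ₀
  have hG : MemLp (fun ξ => (gaussian A b ξ₀ ξ : ℂ)) 2 volume := by
    simpa [weight] using memLp_weight_gaussian hb A ξ₀ 0 (by norm_num)
  set h : L2 := hG.toLp _ with hh
  have hae : (h : ℝ → ℂ) =ᵐ[volume] fun ξ => (gaussian A b ξ₀ ξ : ℂ) := hG.coeFn_toLp
  have hmem : (𝓕⁻ h : L2) ∈ sobolev 1 := by
    refine fourierInv_mem_sobolev ((memLp_weight_gaussian hb A ξ₀ 1 le_rfl).ae_eq ?_)
    filter_upwards [hae] with ξ hξ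
    rw [hξ]
  have hF : (𝓕 (𝓕⁻ h : L2) : L2) = h := FourierTransform.fourier_fourierInv_eq h
  have hnorm : ∀ ξ, ‖(gaussian A b ξ₀ ξ : ℂ)‖ ^ 2 =
      A ^ 2 * Real.exp (-(2 * Real.pi * b) * (ξ - ξ₀) ^ 2) := fun ξ => by
    rw [Complex.norm_real, Real.norm_eq_abs, sq_abs, gaussian_sq]
  refine ⟨𝓕⁻ h, hmem, ?_, ?_, ?_⟩
  · rw [← mass_fourier, hF]
    have : mass h = ∫ ξ, A ^ 2 * Real.exp (-(2 * Real.pi * b) * (ξ - ξ₀) ^ 2) := by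
      refine integral_congr_ae ?_
      filter_upwards [hae] with ξ hξ
      rw [hξ, hnorm]
    rw [this, integral_const_mul,
      integral_sub_right_eq_self (fun ξ => Real.exp (-(2 * Real.pi * b) * ξ ^ 2)) ξ₀,
      integral_gaussian, hA2, mul_assoc, ← Real.sqrt_mul (by positivity)]
    have : 2 * b * (Real.pi / (2 * Real.pi * b)) = 1 := by field_simp
    rw [this, Real.sqrt_one, mul_one]
  · have hc : 0 < Real.pi * b := by positivity
    have e1 : quadForm (fun k => (k - k₀) ^ 2) (𝓕⁻ h) = ∫ ξ, ((2 * Real.pi) ^ 2 * A ^ 2) *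
        ((ξ - ξ₀) ^ 2 * Real.exp (-(2 * (Real.pi * b)) * (ξ - ξ₀) ^ 2)) := by
      unfold quadForm
      rw [hF]
      refine integral_congr_ae ?_
      filter_upwards [hae] with ξ hξ
      rw [hξ, hnorm, ← mul_assoc 2 Real.pi b]
      have : 2 * Real.pi * ξ - k₀ = 2 * Real.pi * (ξ - ξ₀) := by rw [hξ₀]; field_simp
      rw [this]; ring
    have e2 : ∫ y : ℝ, y ^ 2 * Real.exp (-(2 * (Real.pi * b)) * y ^ 2) ≤
        ∫ y, (Real.pi * b)⁻¹ * Real.exp (-(Real.pi * b) * y ^ 2) :=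
      integral_mono (integrable_sq_mul_exp hc) ((integrable_exp_neg_mul_sq hc).const_mul _)
        (sq_mul_exp_le hc)
    rw [e1, integral_const_mul, integral_sub_right_eq_self
      (fun ξ => ξ ^ 2 * Real.exp (-(2 * (Real.pi * b)) * ξ ^ 2)) ξ₀]
    refine (mul_le_mul_of_nonneg_left e2 (by positivity)).trans (le_of_eq ?_)
    rw [integral_const_mul, integral_gaussian, hA2]
    have : Real.sqrt (2 * b) * Real.sqrt (Real.pi / (Real.pi * b)) = Real.sqrt 2 := by
      rw [← Real.sqrt_mul (by positivity)]
      congr 1; field_simp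
    calc _ = (2 * Real.pi) ^ 2 * N * (Real.pi * b)⁻¹ *
          (Real.sqrt (2 * b) * Real.sqrt (Real.pi / (Real.pi * b))) := by ring
      _ = _ := by rw [this]; field_simp; ring
  · have hrep := rep_ae (by norm_num) hmem
    have hrep2 : ∀ x, ‖rep (𝓕⁻ h) x‖ =
        A * b ^ (-(1 / 2) : ℝ) * Real.exp (-(Real.pi / b) * x ^ 2) := by
      intro x
      rw [← norm_fourierInv_gaussian hb hA ξ₀ x]
      unfold rep
      rw [hF, Real.fourierInv_congr_ae hae]
    have hp : 0 < 2 * s + 2 := by linarith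
    have e1 : potential s (𝓕⁻ h) = ∫ x, (A * b ^ (-(1 / 2) : ℝ)) ^ (2 * s + 2) *
        Real.exp (-((2 * s + 2) * Real.pi / b) * x ^ 2) := by
      refine integral_congr_ae ?_
      filter_upwards [hrep] with x hx
      rw [hx, hrep2, Real.mul_rpow (by positivity) (Real.exp_nonneg _), ← Real.exp_mul]
      congr 2; ring
    have e2 : (A * b ^ (-(1 / 2) : ℝ)) ^ 2 = N * Real.sqrt 2 * b ^ (-(1 / 2) : ℝ) := by
      rw [mul_pow, hA2, Real.sqrt_mul (by norm_num), Real.sqrt_eq_rpow b, ← Real.rpow_natCast,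
        ← Real.rpow_mul hb.le]
      have : b ^ (1 / 2 : ℝ) * b ^ (-(1 / 2) * ((2 : ℕ) : ℝ) : ℝ) = b ^ (-(1 / 2) : ℝ) := by
        rw [← Real.rpow_add hb]; norm_num
      rw [← this]; ring
    have e3 : (A * b ^ (-(1 / 2) : ℝ)) ^ (2 * s + 2) =
        (N * Real.sqrt 2) ^ (s + 1) * b ^ (-((s + 1) / 2)) := by
      rw [show 2 * s + 2 = ((2 : ℕ) : ℝ) * (s + 1) by push_cast; ring,
        Real.rpow_mul (by positivity), Real.rpow_natCast, e2,
        Real.mul_rpow (by positivity) (by positivity), ← Real.rpow_mul hb.le]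
      congr 2; ring
    rw [e1, integral_const_mul, integral_gaussian, e3]
    have e4 : Real.pi / ((2 * s + 2) * Real.pi / b) = b / (2 * s + 2) := by field_simp
    rw [e4, Real.sqrt_div hb.le, Real.sqrt_eq_rpow b]
    have e5 : b ^ (-((s + 1) / 2)) * b ^ (1 / 2 : ℝ) = b ^ (-(s / 2)) := by
      rw [← Real.rpow_add hb]; congr 1; ring
    rw [← e5]; ring

/-! ### The linear symbol and the strict energy inequality. -/

/-- The symbol `½|k|^s - βk` of the linear part of the energy. -/
def symbol (s β k : ℝ) : ℝ := 1 / 2 * |k| ^ s + -β * k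

lemma isSymbol_symbol {s : ℝ} (hs : 1 < s) (β : ℝ) : IsSymbol (s / 2) (symbol s β) :=
  ((isSymbol_abs_rpow (by linarith)).const_mul _).add ((isSymbol_id (by linarith)).const_mul _)

lemma energy_eq {s : ℝ} (hs : 1 < s) (β : ℝ) {u : L2} (hu : u ∈ sobolev (s / 2)) :
    energy s β u = quadForm (symbol s β) u - 1 / (2 * s + 2) * potential s u := by
  have h : quadForm (symbol s β) u = 1 / 2 * kinetic s u + -β * momentum u := by
    unfold symbol
    rw [quadForm_add_symbol ((isSymbol_abs_rpow (by linarith)).const_mul _)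
      ((isSymbol_id (by linarith)).const_mul _) hu, quadForm_const_mul_symbol,
      quadForm_const_mul_symbol]
    rfl
  rw [h]; unfold energy; ring

/-- The minimum point of the symbol `½|k|^s - βk`. -/
def criticalFrequency (s β : ℝ) : ℝ := (2 * β / s) ^ (s - 1)⁻¹

lemma criticalFrequency_pos {s β : ℝ} (hs : 1 < s) (hβ : 0 < β) : 0 < criticalFrequency s β := by
  unfold criticalFrequency; positivity

lemma criticalFrequency_spec {s β : ℝ} (hs : 1 < s) (hβ : 0 < β) :
    criticalFrequency s β ^ s = 2 * β / s * criticalFrequency s β := by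
  have h := criticalFrequency_pos hs hβ
  have : criticalFrequency s β ^ (s - 1) = 2 * β / s := by
    unfold criticalFrequency
    exact Real.rpow_inv_rpow (by positivity) (by linarith)
  rw [← this, ← Real.rpow_add_one h.ne']; congr 1; ring

/-- Bernoulli's inequality at |k|/q is the tangent line bound for |k|^s at q; the slope of ½|k|^s
there is β, and βk ≤ β|k|. -/
lemma symbol_criticalFrequency_le {s β : ℝ} (hs : 1 < s) (hβ : 0 < β) (k : ℝ) :
    symbol s β (criticalFrequency s β) ≤ symbol s β k := by
  set q := criticalFrequency s β with hq
  have hqpos : 0 < q := criticalFrequency_pos hs hβ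
  have hspec : q ^ s = 2 * β / s * q := criticalFrequency_spec hs hβ
  have h := one_add_mul_self_le_rpow_one_add (s := |k| / q - 1)
    (by have := div_nonneg (abs_nonneg k) hqpos.le; linarith) hs.le
  rw [show 1 + (|k| / q - 1) = |k| / q by ring, Real.div_rpow (abs_nonneg k) hqpos.le,
    le_div_iff₀ (by positivity), hspec] at h
  have h2 : (1 + s * (|k| / q - 1)) * (2 * β / s * q) =
      2 * β / s * q + 2 * β * (|k| - q) := by field_simp
  rw [h2] at h
  have h3 := mul_le_mul_of_nonneg_left (le_abs_self k) hβ.le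
  unfold symbol
  rw [abs_of_pos hqpos, hspec]
  linarith

/-- For s < 2 the function |k|^s is concave in k². Its tangent at q² yields a global quadratic
majorant touching the symbol at its minimum, so the excess energy of a wave packet is controlled by
its frequency variance. -/
lemma symbol_le_criticalFrequency_add {s β : ℝ} (hs : 1 < s) (hs₂ : s < 2) (hβ : 0 < β) (k : ℝ) :
    symbol s β k ≤ symbol s β (criticalFrequency s β) +
      β / (2 * criticalFrequency s β) * (k - criticalFrequency s β) ^ 2 := by
  set q := criticalFrequency s β with hq
  have hqpos : 0 < q := criticalFrequency_pos hs hβ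
  have hspec : q ^ s = 2 * β / s * q := criticalFrequency_spec hs hβ
  have h := rpow_one_add_le_one_add_mul_self (s := k ^ 2 / q ^ 2 - 1) (p := s / 2)
    (by have : 0 ≤ k ^ 2 / q ^ 2 := by positivity
        linarith) (by linarith) (by linarith)
  have e1 : ∀ x : ℝ, (x ^ 2) ^ (s / 2) = |x| ^ s := by
    intro x
    rw [← sq_abs, ← Real.rpow_natCast, ← Real.rpow_mul (abs_nonneg _)]
    congr 1; push_cast; ring
  rw [show 1 + (k ^ 2 / q ^ 2 - 1) = k ^ 2 / q ^ 2 by ring,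
    Real.div_rpow (by positivity) (by positivity), e1, e1, abs_of_pos hqpos,
    div_le_iff₀ (by positivity), hspec] at h
  have h2 : (1 + s / 2 * (k ^ 2 / q ^ 2 - 1)) * (2 * β / s * q) =
      2 * β / s * q + β * (k ^ 2 - q ^ 2) / q := by field_simp
  rw [h2] at h
  have h3 : β / (2 * q) * (k - q) ^ 2 = 1 / 2 * (β * (k ^ 2 - q ^ 2) / q) - β * k + β * q := by
    field_simp; ring
  unfold symbol
  rw [abs_of_pos hqpos, hspec, h3]
  linarith

/-- The infimum of the energy lies strictly below the bottom of its linear part. -/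
lemma exists_energy_lt {s β N : ℝ} (hs : 1 < s) (hs₂ : s < 2) (hβ : 0 < β) (hN : 0 < N) :
    ∃ u ∈ admissible s N, energy s β u < symbol s β (criticalFrequency s β) * N := by
  set q := criticalFrequency s β with hq
  have hqpos : 0 < q := criticalFrequency_pos hs hβ
  set D := β / (2 * q) * (4 * Real.pi * Real.sqrt 2 * N) with hD
  set c := 1 / (2 * s + 2) * ((N * Real.sqrt 2) ^ (s + 1) / Real.sqrt (2 * s + 2)) with hc
  have hs1 : 0 < s := by linarith
  have hcpos : 0 < c := by positivity
  have hDpos : 0 < D := by positivity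
  -- The cost is at most D/b and the gain is c b^{-s/2}. The gain exceeds the cost exactly when b^{1
  -- - s/2} > D/c, which s < 2 makes possible.
  set b := (D / c + 1) ^ (1 - s / 2)⁻¹ with hb
  have hbpos : 0 < b := by positivity
  have hbpow : b ^ (1 - s / 2) = D / c + 1 :=
    Real.rpow_inv_rpow (by positivity) (by linarith)
  obtain ⟨u, hu1, hmass, hquad, hpot⟩ := exists_wave_packet hs1 hN q hbpos
  have hu : u ∈ sobolev (s / 2) := sobolev_mono (by linarith) hu1
  refine ⟨u, ⟨hu, hmass⟩, ?_⟩
  rw [energy_eq hs β hu, hpot, ← mul_assoc, ← hc]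
  -- The quadratic majorant is form-bounded on H¹ but not on H^{s/2}, so the symbols are compared on
  -- H¹, which contains the wave packets.
  have hsym2 : IsSymbol 1 (fun k : ℝ => (k - q) ^ 2) := by
    refine ⟨by fun_prop, 2 * (2 * Real.pi) ^ 2 + 2 * q ^ 2, fun ξ => ?_⟩
    rw [weight_sq, Real.rpow_one, abs_of_nonneg (by positivity)]
    nlinarith [sq_nonneg (2 * Real.pi * ξ + q), sq_nonneg (q * ξ), sq_nonneg Real.pi]
  have hsym1 : IsSymbol 1 (symbol s β) := by
    obtain ⟨h1, C, hC⟩ := isSymbol_symbol hs β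
    refine ⟨h1, |C|, fun ξ => (hC ξ).trans ?_⟩
    refine (mul_le_mul_of_nonneg_right (le_abs_self C) (by positivity)).trans ?_
    refine mul_le_mul_of_nonneg_left ?_ (abs_nonneg C)
    rw [weight_sq, weight_sq]
    exact Real.rpow_le_rpow_of_exponent_le (by nlinarith [sq_nonneg ξ]) (by linarith)
  have h1 := quadForm_mono hsym1 ((isSymbol_const zero_le_one (symbol s β q)).add
    (hsym2.const_mul (β / (2 * q)))) hu1 (symbol_le_criticalFrequency_add hs hs₂ hβ)
  rw [quadForm_add_symbol (isSymbol_const zero_le_one _) (hsym2.const_mul _) hu1, quadForm_const,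
    quadForm_const_mul_symbol, hmass] at h1
  have h2 := mul_le_mul_of_nonneg_left hquad (by positivity : 0 ≤ β / (2 * q))
  rw [mul_div_assoc', ← hD] at h2
  have h3 : D / b < c * b ^ (-(s / 2)) := by
    rw [div_lt_iff₀ hbpos, mul_assoc, ← Real.rpow_add_one hbpos.ne',
      show -(s / 2) + 1 = 1 - s / 2 by ring, hbpow]
    have : c * (D / c + 1) = D + c := by field_simp
    linarith
  linarith

/-! ### Translations and weak limits. -/

lemma potential_eq_rep {s r : ℝ} (hr : 1 / 2 < r) {u : L2} (hu : u ∈ sobolev r) :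
    potential s u = ∫ x, ‖rep u x‖ ^ (2 * s + 2) := by
  refine integral_congr_ae ?_
  filter_upwards [rep_ae hr hu] with x hx
  rw [hx]

/-- Translations preserve mass, quadratic forms and the potential term. -/
lemma exists_translate {s r : ℝ} (hr : 1 / 2 < r) {u : L2} (hu : u ∈ sobolev r) (x₀ : ℝ) :
    ∃ v ∈ sobolev r, mass v = mass u ∧ (∀ m, quadForm m v = quadForm m u) ∧
      potential s v = potential s u ∧ ∀ x, rep v x = rep u (x + x₀) := by
  set e : ℝ → ℂ := fun ξ => Complex.exp (((2 * Real.pi * ξ * x₀ : ℝ) : ℂ) * Complex.I) with he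
  have hec : Continuous e := by rw [he]; fun_prop
  have hen : ∀ ξ, ‖e ξ‖ = 1 := fun ξ => Complex.norm_exp_ofReal_mul_I _
  have hmul : ∀ f : ℝ → ℂ, MemLp f 2 volume → MemLp (fun ξ => e ξ * f ξ) 2 volume := fun f hf =>
    hf.mono (hec.aestronglyMeasurable.mul hf.1)
      (Filter.Eventually.of_forall fun ξ => by rw [norm_mul, hen, one_mul])
  have hL := hmul _ (Lp.memLp (𝓕 u : L2))
  set v : L2 := 𝓕⁻ (hL.toLp _) with hv
  have hF : (𝓕 v : L2) =ᵐ[volume] fun ξ => e ξ * (𝓕 u : L2) ξ := by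
    rw [hv, FourierTransform.fourier_fourierInv_eq]; exact hL.coeFn_toLp
  have hmem : v ∈ sobolev r := by
    rw [mem_sobolev_iff] at hu ⊢
    refine (hmul _ hu).ae_eq ?_
    filter_upwards [hF] with ξ hξ
    rw [hξ]; ring
  have hquad : ∀ m, quadForm m v = quadForm m u := by
    intro m
    refine integral_congr_ae ?_
    filter_upwards [hF] with ξ hξ
    rw [hξ, norm_mul, hen, one_mul]
  have hrep : ∀ x, rep v x = rep u (x + x₀) := by
    intro x
    rw [rep_eq, rep_eq]
    refine integral_congr_ae ?_
    filter_upwards [hF] with ξ hξ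
    rw [hξ, he, ← mul_assoc, ← Complex.exp_add]
    congr 2; push_cast; ring
  refine ⟨v, hmem, by rw [← quadForm_one, hquad, quadForm_one], hquad, ?_, hrep⟩
  rw [potential_eq_rep hr hmem, potential_eq_rep hr hu]
  simp_rw [hrep]
  exact integral_add_right_eq_self (fun x => ‖rep u x‖ ^ (2 * s + 2)) x₀

/-- Bounded sequences in `L²` have weakly convergent subsequences. -/
lemma exists_weak_limit {g : ℕ → L2} {K : ℝ} (hK : ∀ n, ‖g n‖ ≤ K) :
    ∃ (φ : ℕ → ℕ) (g₀ : L2), StrictMono φ ∧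
      ∀ y : L2, Filter.Tendsto (fun n => inner ℂ y (g (φ n))) Filter.atTop
        (nhds (inner ℂ y g₀)) := by
  -- Makes `L2` separable for instance search, as sequential Banach-Alaoglu requires.
  have : Fact ((2 : ENNReal) ≠ ⊤) := ⟨by norm_num⟩
  obtain ⟨a, -, φ, hφ, ha⟩ := WeakDual.isSeqCompact_closedBall ℂ L2 0 K
    (x := fun n => StrongDual.toWeakDual (InnerProductSpace.toDual ℂ L2 (g n)))
    (fun n => by simpa using hK n)
  refine ⟨φ, (InnerProductSpace.toDual ℂ L2).symm (WeakDual.toStrongDual a), hφ, fun y => ?_⟩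
  have h1 : Filter.Tendsto (fun n => inner ℂ (g (φ n)) y) Filter.atTop (nhds (a y)) :=
    ((WeakDual.eval_continuous y).tendsto a).comp ha
  have h2 : a y = inner ℂ ((InnerProductSpace.toDual ℂ L2).symm (WeakDual.toStrongDual a)) y := by
    rw [InnerProductSpace.toDual_symm_apply]; rfl
  rw [h2] at h1
  have h3 := (Complex.continuous_conj.tendsto _).comp h1
  rw [inner_conj_symm] at h3
  exact h3.congr fun n => inner_conj_symm _ _

/-- The representing vector is m û / ⟨ξ⟩^r, in L² because m = O(⟨ξ⟩^{2r}). The form is therefore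
weakly continuous in its second argument, which kills the cross terms when quadratic forms are
decoupled. -/
lemma exists_bilForm_eq_inner {r : ℝ} {m : ℝ → ℝ} (hm : IsSymbol r m) {u : L2}
    (hu : u ∈ sobolev r) :
    ∃ y : L2, ∀ (v : L2) (hv : v ∈ sobolev r), bilForm m u v = (inner ℂ y (weighted hv)).re := by
  obtain ⟨hmeas, C, hC⟩ := hm
  have hL : MemLp (fun ξ => ((m (2 * Real.pi * ξ) * (weight r ξ)⁻¹ : ℝ) : ℂ) * (𝓕 u : L2) ξ)
      2 volume := by
    refine ((mem_sobolev_iff.1 hu).const_mul (C : ℂ)).mono ?_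
      (Filter.Eventually.of_forall fun ξ => ?_)
    · refine AEStronglyMeasurable.mul ?_ (Lp.aestronglyMeasurable _)
      exact Complex.continuous_ofReal.comp_aestronglyMeasurable
        ((aestronglyMeasurable_symbol hmeas).mul ((continuous_weight r).inv₀
          fun ξ => (weight_pos r ξ).ne').aestronglyMeasurable)
    · have hw := weight_pos r ξ
      rw [norm_mul, norm_mul, norm_mul, ← mul_assoc, Complex.norm_real, Complex.norm_real,
        Complex.norm_real, Real.norm_eq_abs, Real.norm_eq_abs, Real.norm_eq_abs, abs_mul,
        abs_of_pos (inv_pos.2 hw), abs_of_pos hw]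
      refine mul_le_mul_of_nonneg_right ?_ (norm_nonneg _)
      rw [← div_eq_mul_inv, div_le_iff₀ hw]
      refine (hC ξ).trans ?_
      have := mul_le_mul_of_nonneg_right (le_abs_self C) (sq_nonneg (weight r ξ))
      linarith
  refine ⟨hL.toLp _, fun v hv => ?_⟩
  rw [L2.inner_def]
  refine Eq.trans ?_ (integral_re (𝕜 := ℂ) (L2.integrable_inner (𝕜 := ℂ) (hL.toLp _)
    (weighted hv)))
  refine integral_congr_ae ?_
  filter_upwards [hL.coeFn_toLp, weighted_ae hv] with ξ h1 h2
  rw [h1, h2, ← Complex.real_smul, ← Complex.real_smul]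
  have hw := (weight_pos r ξ).ne'
  change _ = inner ℝ ((m (2 * Real.pi * ξ) * (weight r ξ)⁻¹) • (𝓕 u : L2) ξ)
    (weight r ξ • (𝓕 v : L2) ξ)
  rw [real_inner_smul_left, real_inner_smul_right]
  field_simp

/-- Bounded sequences in `H^r`, `r > 1/2`, have subsequences which converge pointwise, and along
which all quadratic forms decouple. -/
lemma exists_sobolev_limit {r : ℝ} (hr : 1 / 2 < r) {v : ℕ → L2} (hv : ∀ n, v n ∈ sobolev r)
    {K : ℝ} (hK : ∀ n, ‖weighted (hv n)‖ ≤ K) :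
    ∃ (φ : ℕ → ℕ) (u : L2), StrictMono φ ∧ u ∈ sobolev r ∧
      (∀ x, Filter.Tendsto (fun n => rep (v (φ n)) x) Filter.atTop (nhds (rep u x))) ∧
      ∀ m, IsSymbol r m → Filter.Tendsto
        (fun n => quadForm m (v (φ n)) - quadForm m (v (φ n) - u)) Filter.atTop
        (nhds (quadForm m u)) := by
  obtain ⟨φ, g, hφ, hg⟩ := exists_weak_limit hK
  have hL : MemLp (fun ξ => (((weight r ξ)⁻¹ : ℝ) : ℂ) * g ξ) 2 volume := by
    refine (Lp.memLp g).mono ?_ (Filter.Eventually.of_forall fun ξ => ?_)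
    · exact (Complex.continuous_ofReal.comp ((continuous_weight r).inv₀
        fun ξ => (weight_pos r ξ).ne')).aestronglyMeasurable.mul (Lp.aestronglyMeasurable g)
    · rw [norm_mul, Complex.norm_real, Real.norm_of_nonneg (inv_nonneg.2 (weight_pos r ξ).le)]
      exact mul_le_of_le_one_left (norm_nonneg _)
        (inv_le_one_of_one_le₀ (one_le_weight (by linarith) ξ))
  set u : L2 := 𝓕⁻ (hL.toLp _) with hudef
  have hwg : (fun ξ => (weight r ξ : ℂ) * (𝓕 u : L2) ξ) =ᵐ[volume] g := by
    rw [hudef, FourierTransform.fourier_fourierInv_eq]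
    filter_upwards [hL.coeFn_toLp] with ξ hξ
    rw [hξ]
    have : (weight r ξ : ℂ) ≠ 0 := by exact_mod_cast (weight_pos r ξ).ne'
    push_cast
    field_simp
  have hu : u ∈ sobolev r := mem_sobolev_iff.2 ((Lp.memLp g).ae_eq hwg.symm)
  have hug : weighted hu = g := Lp.ext ((weighted_ae hu).trans hwg)
  refine ⟨φ, u, hφ, hu, fun x => ?_, fun m hm => ?_⟩
  · simp_rw [rep_eq_inner hr (hv _), rep_eq_inner hr hu, hug]
    exact hg _
  · obtain ⟨y, hy⟩ := exists_bilForm_eq_inner hm hu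
    have h1 : ∀ n, quadForm m (v (φ n)) - quadForm m (v (φ n) - u) =
        quadForm m u + 2 * (inner ℂ y (weighted (hv (φ n))) - inner ℂ y g).re := by
      intro n
      have hw := sub_mem_sobolev (hv (φ n)) hu
      have h := quadForm_add hm hu hw
      rw [add_sub_cancel, hy _ hw, weighted_sub (hv (φ n)) hu, inner_sub_right, hug] at h
      linarith
    simp_rw [h1]
    have h2 := (Complex.continuous_re.tendsto _).comp ((hg y).sub_const (inner ℂ y g))
    have h3 := (h2.const_mul 2).const_add (quadForm m u)
    simpa [Function.comp_def] using h3

/-! ### Coercivity and mass scaling. -/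

/-- Subadditivity of t^{s/2}, valid since s/2 ≤ 1, gives (1 + ξ²)^{s/2} ≤ 1 + |ξ|^s; the factor 2π
only helps. -/
lemma norm_weighted_sq_le {s : ℝ} (hs : 1 < s) (hs₂ : s < 2) {u : L2} (hu : u ∈ sobolev (s / 2)) :
    ‖weighted hu‖ ^ 2 ≤ mass u + kinetic s u := by
  have h1 := integrable_quadForm (isSymbol_const (by linarith : 0 ≤ s / 2) 1) hu
  have h2 := integrable_quadForm (isSymbol_abs_rpow (by linarith : 0 ≤ s)) hu
  rw [norm_weighted_sq, ← quadForm_one]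
  unfold kinetic quadForm
  rw [← integral_add h1 h2]
  refine integral_mono_of_nonneg (Filter.Eventually.of_forall fun ξ => by positivity) (h1.add h2)
    (Filter.Eventually.of_forall fun ξ => ?_)
  simp only
  rw [← add_mul]
  refine mul_le_mul_of_nonneg_right ?_ (by positivity)
  rw [weight_sq]
  refine (Real.rpow_add_le_add_rpow zero_le_one (sq_nonneg ξ) (by linarith)
    (by linarith)).trans ?_
  rw [Real.one_rpow]
  have : (ξ ^ 2) ^ (s / 2) = |ξ| ^ s := by
    rw [← sq_abs, ← Real.rpow_natCast, ← Real.rpow_mul (abs_nonneg _)]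
    congr 1; push_cast; ring
  rw [this]
  have h3 : |ξ| ≤ |2 * Real.pi * ξ| := by
    rw [abs_mul, abs_of_pos (by positivity : 0 < 2 * Real.pi)]
    exact le_mul_of_one_le_left (abs_nonneg ξ) (by linarith [Real.pi_gt_three])
  linarith [Real.rpow_le_rpow (abs_nonneg ξ) h3 (by linarith : 0 ≤ s)]

/-- Below the critical mass the energy controls the kinetic energy. -/
lemma IsGroundState.exists_coercive {s β N : ℝ} (hs : 1 < s) (hβ : 0 < β) {Q : L2}
    (hQ : IsGroundState s Q) (hN : 0 < N) (hNQ : N < mass Q) :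
    ∃ δ C, 0 < δ ∧ ∀ u ∈ admissible s N, δ * kinetic s u - C ≤ energy s β u := by
  have hM : 0 < mass Q := hN.trans hNQ
  set θ := (N / mass Q) ^ s with hθ
  have hθ1 : θ < 1 := Real.rpow_lt_one (by positivity) ((div_lt_one hM).2 hNQ) (by linarith)
  -- The potential leaves (1 - θ)/2 of the kinetic energy. Half of this absorbs the momentum and
  -- half remains as coercivity. Below, R is the frequency beyond which β|k| ≤ δ|k|^s.
  set δ := (1 - θ) / 4 with hδ
  have hδ0 : 0 < δ := by rw [hδ]; linarith
  set R := (β / δ) ^ (s - 1)⁻¹ with hR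
  have hR0 : 0 < R := by positivity
  have hRs : R ^ (s - 1) = β / δ := Real.rpow_inv_rpow (by positivity) (by linarith)
  have hsym : ∀ k : ℝ, (1 / 2 - δ) * |k| ^ s + -(β * R) ≤ symbol s β k := by
    intro k
    have h1 : β * |k| ≤ δ * |k| ^ s + β * R := by
      rcases le_or_gt |k| R with h | h
      · have : 0 ≤ δ * |k| ^ s := by positivity
        nlinarith
      · have hk : 0 < |k| := hR0.trans h
        have h2 : β / δ ≤ |k| ^ (s - 1) := by
          rw [← hRs]; exact Real.rpow_le_rpow hR0.le h.le (by linarith)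
        rw [div_le_iff₀ hδ0] at h2
        have h3 : |k| ^ s = |k| ^ (s - 1) * |k| := by
          rw [← Real.rpow_add_one hk.ne']; congr 1; ring
        have h4 := mul_le_mul_of_nonneg_right h2 hk.le
        have : 0 < β * R := by positivity
        rw [h3]; linarith
    have h5 := mul_le_mul_of_nonneg_left (le_abs_self k) hβ.le
    unfold symbol
    linarith
  refine ⟨δ, β * R * N, hδ0, fun u hu => ?_⟩
  obtain ⟨hu, hmass⟩ := hu
  have hk := (isSymbol_abs_rpow (by linarith : 0 ≤ s)).const_mul (1 / 2 - δ)
  have hc := isSymbol_const (by linarith : 0 ≤ s / 2) (-(β * R))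
  have h1 := quadForm_mono (hk.add hc) (isSymbol_symbol hs β) hu hsym
  rw [quadForm_add_symbol hk hc hu, quadForm_const_mul_symbol, quadForm_const, hmass] at h1
  have h2 := hQ.gagliardo_nirenberg hs hu
  rw [hmass, ← hθ] at h2
  rw [energy_eq hs β hu]
  have h3 : 1 / (2 * s + 2) * potential s u ≤ 1 / 2 * θ * kinetic s u := by
    rw [one_div_mul_eq_div, div_le_iff₀ (by linarith)]
    linarith
  have h4 : (1 / 2 - δ) * kinetic s u - 1 / 2 * θ * kinetic s u = δ * kinetic s u := by
    rw [hδ]; ring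
  change (1 / 2 - δ) * kinetic s u + _ ≤ _ at h1
  linarith

/-- Scaling the mass by a constant multiple. -/
lemma le_energy_of_mass {s β N E : ℝ} (hs : 1 < s) (hN : 0 < N)
    (hE : ∀ u ∈ admissible s N, E ≤ energy s β u) {v : L2} (hv : v ∈ sobolev (s / 2))
    (hv0 : v ≠ 0) :
    E ≤ N / mass v * quadForm (symbol s β) v -
      1 / (2 * s + 2) * ((N / mass v) ^ (s + 1) * potential s v) := by
  have hm := mass_pos hv0
  set c : ℂ := (Real.sqrt (N / mass v) : ℂ) with hc
  have hc1 : ‖c‖ = Real.sqrt (N / mass v) := by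
    rw [hc, Complex.norm_real, Real.norm_of_nonneg (Real.sqrt_nonneg _)]
  have hc2 : ‖c‖ ^ 2 = N / mass v := by rw [hc1, Real.sq_sqrt (by positivity)]
  have hc3 : ‖c‖ ^ (2 * s + 2) = (N / mass v) ^ (s + 1) := by
    rw [← hc2, ← Real.rpow_natCast, ← Real.rpow_mul (norm_nonneg _)]
    congr 1; push_cast; ring
  have hcv := smul_mem_sobolev c hv
  have h := hE (c • v) ⟨hcv, by rw [mass_smul, hc2]; field_simp⟩
  rwa [energy_eq hs β hcv, quadForm_smul, potential_smul, hc2, hc3] at h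

/-- Under v ↦ cv the quadratic part scales like the mass and the potential by the larger power s + 1
of the mass ratio. The extra term is strict subadditivity in quantitative form: positive when 0 <
mass v < N and the potential is positive. -/
lemma le_energy_of_scaling {s β N E : ℝ} (hs : 1 < s) (hN : 0 < N)
    (hE : ∀ u ∈ admissible s N, E ≤ energy s β u) {v : L2} (hv : v ∈ sobolev (s / 2))
    (hv0 : v ≠ 0) :
    mass v / N * E + 1 / (2 * s + 2) * (((N / mass v) ^ s - 1) * potential s v) ≤
      energy s β v := by
  have hm := mass_pos hv0
  have h := le_energy_of_mass hs hN hE hv hv0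
  have hk : 0 < mass v / N := by positivity
  have h2 := mul_le_mul_of_nonneg_left h hk.le
  rw [energy_eq hs β hv]
  have h3 : mass v / N * (N / mass v) = 1 := by field_simp
  have h4 : (N / mass v) ^ (s + 1) = (N / mass v) ^ s * (N / mass v) :=
    Real.rpow_add_one (by positivity) s
  rw [h4] at h2
  have h5 : mass v / N * (N / mass v * quadForm (symbol s β) v -
      1 / (2 * s + 2) * ((N / mass v) ^ s * (N / mass v) * potential s v)) =
      (mass v / N * (N / mass v)) * (quadForm (symbol s β) v -
      1 / (2 * s + 2) * ((N / mass v) ^ s * potential s v)) := by ring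
  rw [h5, h3, one_mul] at h2
  linarith

/-- Covers remainders that vanish, to which the scaling inequality does not apply. -/
lemma energy_zero {s : ℝ} (hs : 1 < s) (β : ℝ) : energy s β (0 : L2) = 0 := by
  have h0 : (0 : L2) ∈ sobolev (s / 2) := by
    have := smul_mem_sobolev (r := s / 2) 0 (show (0 : L2) ∈ sobolev (s / 2) from by
      rw [mem_sobolev_iff]
      have hF : (𝓕 (0 : L2) : L2) = 0 := (Lp.fourierTransformₗᵢ ℝ ℂ).map_zero
      rw [hF]
      refine (MemLp.zero (ε := ℂ) (p := 2)).ae_eq ?_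
      filter_upwards [Lp.coeFn_zero ℂ 2 (volume : Measure ℝ)] with ξ hξ
      rw [hξ]; simp)
    simpa using this
  have h1 := quadForm_smul (symbol s β) 0 (0 : L2)
  have h2 := potential_smul (s := s) 0 (0 : L2)
  rw [norm_zero, Real.zero_rpow (by linarith), smul_zero, zero_mul] at h2
  rw [norm_zero, smul_zero] at h1
  rw [energy_eq hs β h0, h1, h2]; ring

/-! ### The travelling wave equation. -/

/-- Constrained minimizers solve the travelling wave equation. -/
lemma IsMinimizer.exists_solves {s β N : ℝ} (hs : 1 < s) (hN : 0 < N) {u : L2}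
    (hu : IsMinimizer s β N u) : ∃ γ, SolvesTravellingWave s β γ u := by
  obtain ⟨⟨hmem, hmass⟩, hmin⟩ := hu
  have hu0 : u ≠ 0 := fun h => by rw [mass_eq_zero.2 h] at hmass; linarith
  obtain ⟨B, -, hB⟩ := ae_norm_le (by linarith) hmem
  have hL := memLp_nonlinearity (s := s) (by linarith) hB
  set E := energy s β u with hE
  have hmin' : ∀ v ∈ admissible s N, E ≤ energy s β v := fun v hv => hmin hv
  -- Minimality tested on v rescaled to mass N and multiplied by (mass v)^{s+1}, which clears the
  -- denominators and frees v from the constraint.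
  have hnonneg : ∀ v ∈ sobolev (s / 2), 0 ≤ N * (quadForm (symbol s β) v * mass v ^ s) -
      N ^ (s + 1) / (2 * s + 2) * potential s v - E * mass v ^ (s + 1) := by
    intro v hv
    by_cases hv0 : v = 0
    · have h2 := potential_smul (s := s) 0 (0 : L2)
      rw [norm_zero, Real.zero_rpow (by linarith), smul_zero, zero_mul] at h2
      rw [hv0, h2, mass_eq_zero.2 rfl, Real.zero_rpow (by linarith), Real.zero_rpow (by linarith)]
      simp
    · have hm := mass_pos hv0
      have h := le_energy_of_mass hs hN hmin' hv hv0
      have h2 := mul_le_mul_of_nonneg_right h (Real.rpow_nonneg hm.le (s + 1))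
      rw [Real.div_rpow hN.le hm.le] at h2
      have h3 : mass v ^ (s + 1) = mass v ^ s * mass v := Real.rpow_add_one hm.ne' s
      have h4 : (N / mass v * quadForm (symbol s β) v - 1 / (2 * s + 2) *
          (N ^ (s + 1) / mass v ^ (s + 1) * potential s v)) * mass v ^ (s + 1) =
          N * (quadForm (symbol s β) v * mass v ^ s) -
          N ^ (s + 1) / (2 * s + 2) * potential s v := by
        have h5 : mass v ^ (s + 1) ≠ 0 := (Real.rpow_pos_of_pos hm _).ne'
        have h6 : N / mass v * quadForm (symbol s β) v * mass v ^ (s + 1) =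
            N * (quadForm (symbol s β) v * mass v ^ s) := by
          rw [h3]; field_simp
        rw [sub_mul, h6]
        congr 1
        field_simp
      linarith
  have hNs : N ^ (s + 1) = N ^ s * N := Real.rpow_add_one hN.ne' s
  have hEL := euler_lagrange (s := s) (r := s / 2) (by linarith) (by linarith)
    (isSymbol_symbol hs β) hmem hu0 hnonneg
    (by rw [hmass, hE, energy_eq hs β hmem, hNs]; field_simp; ring) hL.coeFn_toLp
  set κ := N * quadForm (symbol s β) u * s * mass u ^ (s - 1) - E * (s + 1) * mass u ^ s
  -- The variational equation carries the factor N^{s+1}/2 in front of |k|^s and of the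
  -- nonlinearity; dividing by it normalizes κ to γ.
  refine ⟨2 * κ / N ^ (s + 1), hL.toLp _, hL.coeFn_toLp, ?_⟩
  filter_upwards [hEL] with ξ hξ
  rw [hmass] at hξ
  have hNpos : (N ^ (s + 1) : ℝ) ≠ 0 := (Real.rpow_pos_of_pos hN _).ne'
  have h1 : N * N ^ s * symbol s β (2 * Real.pi * ξ) + κ = N ^ (s + 1) / 2 *
      (|2 * Real.pi * ξ| ^ s - 2 * β * (2 * Real.pi * ξ) + 2 * κ / N ^ (s + 1)) := by
    unfold symbol
    rw [mul_comm N (N ^ s), ← hNs]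
    field_simp
    ring
  have h2 : N ^ (s + 1) / (2 * s + 2) * (s + 1) = N ^ (s + 1) / 2 := by field_simp
  rw [h1, h2, Complex.ofReal_mul, mul_assoc, ← mul_sub] at hξ
  have h3 : ((N ^ (s + 1) / 2 : ℝ) : ℂ) ≠ 0 := by exact_mod_cast (by positivity)
  exact sub_eq_zero.1 ((mul_eq_zero.1 hξ).resolve_left h3)

/-! ### Existence of a minimizer. -/

/-- The potential term is controlled by the supremum of the continuous representative. -/
lemma potential_le_of_rep_le {s : ℝ} (hs : 1 < s) {u : L2} (hu : u ∈ sobolev (s / 2)) {η : ℝ}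
    (h : ∀ x, ‖rep u x‖ ≤ η) : potential s u ≤ η ^ (2 * s) * mass u := by
  have hae : ∀ᵐ x, ‖u x‖ ≤ η := by
    filter_upwards [rep_ae (by linarith) hu] with x hx
    rw [hx]; exact h x
  unfold potential mass
  rw [← integral_const_mul]
  refine integral_mono_ae (integrable_norm_rpow (by linarith) hae)
    (((Lp.memLp u).integrable_norm_pow (by norm_num)).const_mul _) ?_
  filter_upwards [hae] with x hx
  have h0 := norm_nonneg (u x)
  have : ‖u x‖ ^ (2 * s + 2) = ‖u x‖ ^ (2 * s) * ‖u x‖ ^ 2 := by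
    rw [← Real.rpow_natCast, ← Real.rpow_add' h0 (by push_cast; linarith)]; norm_num
  rw [this]
  exact mul_le_mul_of_nonneg_right (Real.rpow_le_rpow h0 hx (by linarith)) (by positivity)

lemma mass_le_norm_weighted_sq {r : ℝ} (hr : 0 ≤ r) {u : L2} (hu : u ∈ sobolev r) :
    mass u ≤ ‖weighted hu‖ ^ 2 := by
  rw [← mass_fourier, ← mass_eq_norm_sq]
  refine integral_mono_ae ((Lp.memLp _).integrable_norm_pow (by norm_num))
    ((Lp.memLp _).integrable_norm_pow (by norm_num)) ?_
  filter_upwards [weighted_ae hu] with ξ hξ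
  rw [hξ, norm_mul, Complex.norm_real, Real.norm_of_nonneg (weight_pos r ξ).le]
  exact pow_le_pow_left₀ (norm_nonneg _)
    (le_mul_of_one_le_left (norm_nonneg _) (one_le_weight hr ξ)) 2

/-- The potential term decouples along bounded sequences in `H^{s/2}` converging pointwise. -/
lemma tendsto_potential_sub {s : ℝ} (hs : 1 < s) {v : ℕ → L2} {u : L2}
    (hv : ∀ n, v n ∈ sobolev (s / 2)) (hu : u ∈ sobolev (s / 2)) {K : ℝ}
    (hK : ∀ n, ‖weighted (hv n)‖ ≤ K)
    (hlim : ∀ x, Filter.Tendsto (fun n => rep (v n) x) Filter.atTop (nhds (rep u x))) :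
    Filter.Tendsto (fun n => potential s (v n) - potential s (v n - u)) Filter.atTop
      (nhds (potential s u)) := by
  have hr : 1 / 2 < s / 2 := by linarith
  obtain ⟨C, hC0, hC⟩ := exists_norm_rep_le hr
  have hw : ∀ n, v n - u ∈ sobolev (s / 2) := fun n => sub_mem_sobolev (hv n) hu
  set L := K + ‖weighted hu‖ with hL
  have hK0 : 0 ≤ K := (norm_nonneg _).trans (hK 0)
  have hwK : ∀ n, ‖weighted (hw n)‖ ≤ L := fun n => by
    rw [weighted_sub (hv n) hu]
    exact (norm_sub_le _ _).trans (by linarith [hK n])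
  have hbd : ∀ (f : L2) (hf : f ∈ sobolev (s / 2)), ‖weighted hf‖ ≤ L →
      ∀ᵐ x, ‖f x‖ ≤ C * L := by
    intro f hf hfL
    filter_upwards [rep_ae hr hf] with x hx
    rw [hx]
    exact (hC f hf x).trans (mul_le_mul_of_nonneg_left hfL hC0)
  have hmassL : ∀ n, ∫ x, ‖(v n - u : L2) x‖ ^ 2 ≤ L ^ 2 := fun n =>
    (mass_le_norm_weighted_sq (by linarith) (hw n)).trans
      (pow_le_pow_left₀ (norm_nonneg _) (hwK n) 2)
  have hBL := brezis_lieb (μ := volume) (p := 2 * s + 2) (by linarith) (Lp.memLp u)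
    (fun n => Lp.memLp (v n - u)) (hbd u hu (by rw [hL]; linarith))
    (fun n => hbd _ (hw n) (hwK n)) ?_ hmassL
  · have heq : ∀ n, ∫ x, (‖u x + (v n - u : L2) x‖ ^ (2 * s + 2) -
        ‖(v n - u : L2) x‖ ^ (2 * s + 2) - ‖u x‖ ^ (2 * s + 2)) =
        potential s (v n) - potential s (v n - u) - potential s u := by
      intro n
      have hvL : ‖weighted (hv n)‖ ≤ L := (hK n).trans (by
        rw [hL]; linarith [norm_nonneg (weighted hu)])
      have i1 := integrable_norm_rpow (p := 2 * s + 2) (by linarith) (hbd _ (hv n) hvL)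
      have i2 := integrable_norm_rpow (p := 2 * s + 2) (by linarith) (hbd _ (hw n) (hwK n))
      have i3 := integrable_norm_rpow (p := 2 * s + 2) (by linarith)
        (hbd u hu (by rw [hL]; linarith))
      unfold potential
      rw [← integral_sub i1 i2]
      refine Eq.trans ?_ (integral_sub (i1.sub i2) i3)
      refine integral_congr_ae ?_
      filter_upwards [Lp.coeFn_sub (v n) u] with x hx
      have : u x + (v n - u : L2) x = (v n) x := by rw [hx, Pi.sub_apply]; ring
      rw [this]
    simp_rw [heq] at hBL
    have := hBL.add_const (potential s u)
    simpa using this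
  · have h1 : ∀ᵐ x, ∀ n, (v n - u : L2) x = rep (v n - u) x :=
      ae_all_iff.2 fun n => rep_ae hr (hw n)
    filter_upwards [h1] with x hx
    simp_rw [hx, rep_sub hr (hv _) hu]
    simpa using (hlim x).sub_const (rep u x)

lemma exists_isMinimizer {s β N : ℝ} (hs : 1 < s) (hs₂ : s < 2) (hβ : 0 < β) {Q : L2}
    (hQ : IsGroundState s Q) (hN : 0 < N) (hNQ : N < mass Q) :
    ∃ u, IsMinimizer s β N u := by
  have hr : 1 / 2 < s / 2 := by linarith
  obtain ⟨δ, C, hδ, hcoer⟩ := hQ.exists_coercive hs hβ hN hNQ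
  obtain ⟨u₀, hu₀, hu₀lt⟩ := exists_energy_lt hs hs₂ hβ hN
  set q := symbol s β (criticalFrequency s β) with hq
  set S := energy s β '' admissible s N with hS
  have hbdd : BddBelow S := by
    refine ⟨-C, ?_⟩
    rintro _ ⟨u, hu, rfl⟩
    have := hcoer u hu
    have h2 := mul_nonneg hδ.le (kinetic_nonneg s u)
    linarith
  set E := sInf S with hEdef
  have hE : ∀ u ∈ admissible s N, E ≤ energy s β u := fun u hu =>
    csInf_le hbdd (Set.mem_image_of_mem _ hu)
  have hEq : E < q * N := (hE u₀ hu₀).trans_lt hu₀lt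
  -- Half the energy gap, so that qN - d = E + d. Then η solves η^{2s} N = (2s+2)d: a function
  -- bounded by η has potential energy at most d, hence energy at least E + d, contradicting the
  -- choice of the sequence.
  set d := (q * N - E) / 2 with hd
  have hd0 : 0 < d := by rw [hd]; linarith
  -- a minimizing sequence of low energy, normalized by translations
  set η := ((2 * s + 2) * d / N) ^ (2 * s)⁻¹ with hη
  have hη0 : 0 < η := by positivity
  have hηpow : η ^ (2 * s) = (2 * s + 2) * d / N :=
    Real.rpow_inv_rpow (by positivity) (by linarith)
  have hseq : ∀ n : ℕ, ∃ v ∈ admissible s N, energy s β v < E + min d (1 / (n + 1)) ∧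
      η ≤ ‖rep v 0‖ := by
    intro n
    have hpos : 0 < min d (1 / ((n : ℝ) + 1)) := lt_min hd0 (by positivity)
    obtain ⟨_, ⟨u, hu, rfl⟩, hlt⟩ := exists_lt_of_csInf_lt (s := S) ⟨_, u₀, hu₀, rfl⟩
      (show sInf S < E + min d (1 / ((n : ℝ) + 1)) by linarith)
    obtain ⟨x, hx⟩ : ∃ x, η ≤ ‖rep u x‖ := by
      by_contra! hcon
      have h1 := potential_le_of_rep_le hs hu.1 fun x => (hcon x).le
      rw [hηpow, hu.2, div_mul_cancel₀ _ hN.ne'] at h1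
      have h2 := quadForm_mono (isSymbol_const (by linarith) q) (isSymbol_symbol hs β) hu.1
        (symbol_criticalFrequency_le hs hβ)
      rw [quadForm_const, hu.2] at h2
      rw [energy_eq hs β hu.1] at hlt
      have h3 : 1 / (2 * s + 2) * potential s u ≤ d := by
        rw [one_div_mul_eq_div, div_le_iff₀ (by linarith)]; linarith
      have h4 := min_le_left d (1 / ((n : ℝ) + 1))
      linarith
    obtain ⟨v, hv, hmass, hquad, hpot, hrep⟩ := exists_translate (s := s) hr hu.1 x
    refine ⟨v, ⟨hv, hmass.trans hu.2⟩, ?_, by rwa [hrep, zero_add]⟩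
    rwa [energy_eq hs β hv, hquad, hpot, ← energy_eq hs β hu.1]
  choose v hvadm hvE hvη using hseq
  have hv : ∀ n, v n ∈ sobolev (s / 2) := fun n => (hvadm n).1
  have hvlim : Filter.Tendsto (fun n => energy s β (v n)) Filter.atTop (nhds E) := by
    have h1 := (tendsto_one_div_add_atTop_nhds_zero_nat (𝕜 := ℝ)).const_add E
    rw [add_zero] at h1
    refine tendsto_of_tendsto_of_tendsto_of_le_of_le tendsto_const_nhds h1
      (fun n => hE _ (hvadm n)) fun n => (hvE n).le.trans ?_
    simp
  set K := Real.sqrt (N + (E + d + C) / δ) with hK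
  have hvK : ∀ n, ‖weighted (hv n)‖ ≤ K := by
    intro n
    refine Real.le_sqrt_of_sq_le ((norm_weighted_sq_le hs hs₂ (hv n)).trans ?_)
    rw [(hvadm n).2]
    have h1 := hcoer _ (hvadm n)
    have h2 := hvE n
    have h3 := min_le_left d (1 / ((n : ℝ) + 1))
    have h4 : kinetic s (v n) ≤ (E + d + C) / δ := by
      rw [le_div_iff₀ hδ]; linarith
    linarith
  obtain ⟨φ, u, hφ, hu, hrep, hquad⟩ := exists_sobolev_limit hr hv hvK
  have hpot := tendsto_potential_sub hs (fun n => hv (φ n)) hu (fun n => hvK (φ n)) hrep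
  have hw : ∀ n, v (φ n) - u ∈ sobolev (s / 2) := fun n => sub_mem_sobolev (hv _) hu
  -- The lower bound η at the origin survives because convergence holds at every point, not just
  -- almost everywhere.
  have hu0 : u ≠ 0 := by
    intro h0
    have h1 : η ≤ ‖rep u 0‖ := ge_of_tendsto' (hrep 0).norm fun n => hvη (φ n)
    have h2 := rep_sub hr hu hu 0
    rw [sub_self, sub_self, ← h0] at h2
    rw [h2, norm_zero] at h1
    linarith
  have hm := mass_pos hu0
  have hmass : Filter.Tendsto (fun n => mass (v (φ n) - u)) Filter.atTop (nhds (N - mass u)) := by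
    have h1 := (hquad _ (isSymbol_const (by linarith) 1)).const_sub N
    simp_rw [quadForm_one, (hvadm _).2] at h1
    simpa using h1
  have henergy : Filter.Tendsto (fun n => energy s β (v (φ n) - u)) Filter.atTop
      (nhds (E - energy s β u)) := by
    have h1 := (hquad _ (isSymbol_symbol hs β)).sub (hpot.const_mul (1 / (2 * s + 2)))
    rw [← energy_eq hs β hu] at h1
    have h2 := (hvlim.comp hφ.tendsto_atTop).sub h1
    refine h2.congr fun n => ?_
    simp only [Function.comp_apply]
    rw [energy_eq hs β (hv _), energy_eq hs β (hw n)]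
    ring
  -- Since u carries positive mass, the remainders eventually have mass below N, so the extra
  -- scaling term is nonnegative and can be dropped.
  have hle : ∀ᶠ n in Filter.atTop, mass (v (φ n) - u) / N * E ≤ energy s β (v (φ n) - u) := by
    filter_upwards [hmass.eventually_lt_const (show N - mass u < N by linarith)] with n hn
    by_cases h0 : v (φ n) - u = 0
    · rw [h0, mass_eq_zero.2 rfl, energy_zero hs]; simp
    · have h1 := le_energy_of_scaling hs hN hE (hw n) h0
      have h2 : 1 ≤ (N / mass (v (φ n) - u)) ^ s :=
        Real.one_le_rpow ((one_le_div (mass_pos h0)).2 hn.le) (by linarith)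
      have h3 : 0 ≤ 1 / (2 * s + 2) * (((N / mass (v (φ n) - u)) ^ s - 1) *
          potential s (v (φ n) - u)) :=
        mul_nonneg (by have : 0 < 2 * s + 2 := by linarith
                       positivity) (mul_nonneg (by linarith) (potential_nonneg _ _))
      linarith
  have hkey : (N - mass u) / N * E ≤ E - energy s β u :=
    le_of_tendsto_of_tendsto ((hmass.div_const N).mul_const E) henergy hle
  have hle_N : mass u ≤ N := by
    have := ge_of_tendsto' hmass fun n => mass_nonneg _
    linarith
  have hkey2 : energy s β u ≤ mass u / N * E := by
    have : (N - mass u) / N * E = E - mass u / N * E := by field_simp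
    linarith
  -- For smaller mass the scaling inequality for u is strict, as its potential is positive, and
  -- contradicts the upper bound `hkey2`.
  have hmassN : mass u = N := by
    by_contra hne
    have hlt : mass u < N := lt_of_le_of_ne hle_N hne
    have h1 := le_energy_of_scaling hs hN hE hu hu0
    have h2 : 1 < (N / mass u) ^ s := Real.one_lt_rpow ((one_lt_div hm).2 hlt) (by linarith)
    have h3 : 0 < 1 / (2 * s + 2) * (((N / mass u) ^ s - 1) * potential s u) :=
      mul_pos (by have : 0 < 2 * s + 2 := by linarith
                  positivity) (mul_pos (by linarith) (potential_pos hs hu hu0))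
    linarith
  refine ⟨u, ⟨hu, hmassN⟩, fun w hw' => ?_⟩
  rw [hmassN, div_self hN.ne', one_mul] at hkey2
  exact hkey2.trans (hE w hw')

end FracNLS

end

theorem theorem1 (s β : ℝ) (hs₁ : 1 < s) (hs₂ : s < 2) (hβ : 0 < β)
    (Q : FracNLS.L2) (hQ : FracNLS.IsGroundState s Q)
    (N : ℝ) (hN : 0 < N) (hNQ : N < FracNLS.mass Q) :
    ∃ u : FracNLS.L2, FracNLS.IsMinimizer s β N u ∧
      ∃ γ : ℝ, FracNLS.SolvesTravellingWave s β γ u := by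
  obtain ⟨u, hu⟩ := FracNLS.exists_isMinimizer hs₁ hs₂ hβ hQ hN hNQ
  exact ⟨u, hu, hu.exists_solves hs₁ hN⟩
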